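/- **Notation.** Let $d\ge 1$. For $\mathbf s\in\mathbb N_0^d$ let $\rho(\mathbf s)=\{\mathbf k\in\mathbb Z^d: [2^{s_i-1}]\le |k_i|<2^{s_i},\ i=1,\dots,d\}$, where $[\cdot]$ is the integer part, and for $j\in\mathbb N_0$ let $\Delta Q_j=\bigcup_{\|\mathbf s\|_1=j}\rho(\mathbf s)$. Let $1<p<\infty$, let $(\Omega,\mu)$ be a probability space and let $\Psi=\{\psi_{\mathbf k}\}_{\mathbf k\in\mathbb Z^d}$ be a system in the complex space $L_p(\Omega,\mu)$. For $a>0$, $b\in\mathbb R$, $\beta\in(0,1]$, an *admissible representation* of $f\in L_p(\Omega,\mu)$ is a representation $$f=\sum_{\mathbf k\in\mathbb Z^d}a_{\mathbf k}\psi_{\mathbf k},\qquad \sum_{\mathbf k}|a_{\mathbf k}|<\infty,\qquad \Big(\sum_{\mathbf k\in\Delta Q_j}|a_{\mathbf k}|^\beta\Big)^{1/\beta}\le 2^{-aj}\max(j,1)^{(d-1)b}\quad (j\in\mathbb N_0),$$ the series converging in $L_p(\Omega,\mu)$. The class $\mathbf W^{a,b}_{A_\beta}(\Psi)$ is the set of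 all $f$ that have an admissible representation. For a finite $Q\subset\mathbb Z^d$, a *$v$-term approximant from $\Psi(Q)$* is a linear combination of at most $v$ of the elements $\psi_{\mathbf k}$, $\mathbf k\in Q$. *Weak Chebyshev Greedy Algorithm (WCGA)* with weakness parameter $t\in(0,1]$, for a finite system $\mathcal D$ in a Banach space $X$ and $r\in X$: put $G_0=0$; given $G_i$, take a norming functional $F$ of the residual $r-G_i$ ($\|F\|\le 1$, $F(r-G_i)=\|r-G_i\|$), choose any $\varphi_{i+1}\in\mathcal D$ with $|F(\varphi_{i+1})|\ge t\max_{g\in\mathcal D}|F(g)|$, and let $G_{i+1}$ be a best approximant of $r$ from $\operatorname{span}(\varphi_1,\dots,\varphi_{i+1})$. *Layerwise greedy method*, with parameters $t\in(0,1]$, $J\in\mathbb N_0$ and $\theta_j,w_j\in\mathbb N_0$ ($0\le j<J$), applied to $\sum_{\mathbf k}a_{\mathbf k}\psi_{\mathbf k}$ in $L_p(\Omega,\mu)$: for each $j<J$ keep the terms with the $\min(\theta_j,|\Delta Q_j|)$ largest $|a_{\mathbf k}|$, $\mathbf k\in\Delta Q_j$, and apply $w_j$ iterations of the WCGA with parameter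 $t$ and system $\{\psi_{\mathbf k}\}_{\mathbf k\in\Delta Q_j}$ to the sum of the other terms with $\mathbf k\in\Delta Q_j$; return the sum over $j<J$ of the kept terms and of the WCGA approximants. **Theorem 5.1.** Let $d\ge1$, $1<p<\infty$, $a>0$, $b\in\mathbb R$, $\beta\in(0,1]$, and $p^*:=\min(p,2)$. There are positive constants $c=c(a,\beta,d,p)$ and $C=C(a,b,\beta,d,p)$ such that for every $v\in\mathbb N$, $v\ge1$, there are a finite set $Q\subset\mathbb Z^d$ with $|Q|\le v^c$ and parameters of a layerwise greedy method, both independent of $\Omega$, $\mu$ and $\Psi$, with the following property. Let $\mu$ be a probability measure on a measurable space $\Omega$ and let $\|\psi_{\mathbf k}\|_{L_p(\Omega,\mu)}\le1$ for all $\mathbf k\in\mathbb Z^d$. Then for every $f\in\mathbf W^{a,b}_{A_\beta}(\Psi)$ the method, applied to any admissible representation of $f$, can be carried out, and whatever choices are made in it, its result $A_{v,\mu}(f)$ is a $v$-term approximant from $\Psi(Q)$ and $$\|f-A_{v,\mu}(f)\|_{L_p(\Omega,\mu)}\le C\,v^{-a+1/p^*-1/\beta}\,(\log(2v))^{(d-1)(a+b)}.$$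 -/

import Mathlib

open MeasureTheory
open scoped ENNReal

noncomputable section

namespace MixedGreedy

/-- The dyadic block `ρ(s) = {k ∈ ℤ^d : ⌊2^(s_i - 1)⌋ ≤ |k_i| < 2^(s_i) for all i}`.
The natural-number quotient `2 ^ s i / 2` is `⌊2^(s_i - 1)⌋` (it is `0` when `s_i = 0`). -/
def block {d : ℕ} (s : Fin d → ℕ) : Finset (Fin d → ℤ) :=
  Fintype.piFinset fun i =>
    (Finset.Ioo (-(2 ^ s i : ℤ)) (2 ^ s i)).filter fun k => 2 ^ s i / 2 ≤ k.natAbs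

/-- The hyperbolic layer of level `j`: the union of the blocks `ρ(s)` over `s ∈ ℕ₀^d` with
`s_1 + ⋯ + s_d = j`. -/
def layer (d j : ℕ) : Finset (Fin d → ℤ) :=
  (Finset.piAntidiag (Finset.univ : Finset (Fin d)) j).biUnion block

section NormedSpace

variable {X : Type*} [NormedAddCommGroup X] [NormedSpace ℂ X]

/-- `coef` are the coefficients of an absolutely convergent representation
`f = ∑ coef k • ψ k` whose layers `f_j` satisfy
`|f_j|_{A_β} = (∑_{k in layer j} |coef k|^β)^(1/β) ≤ 2^(-a j) max(j,1)^((d-1) b)`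
for all `j = 0, 1, 2, …`. -/
def IsAdmissibleRep {d : ℕ} (a b β : ℝ) (ψ : (Fin d → ℤ) → X) (f : X)
    (coef : (Fin d → ℤ) → ℂ) : Prop :=
  Summable (fun k => ‖coef k‖) ∧
  HasSum (fun k => coef k • ψ k) f ∧
  ∀ j : ℕ, (∑ k ∈ layer d j, ‖coef k‖ ^ β) ^ (1 / β) ≤
    (2 : ℝ) ^ (-(a * j)) * (max (j : ℝ) 1) ^ (((d : ℝ) - 1) * b)

/-- The class `W^{a,b}_{A_β}(Ψ)`. -/
def mixedClass {d : ℕ} (a b β : ℝ) (ψ : (Fin d → ℤ) → X) : Set X :=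
  {f | ∃ coef, IsAdmissibleRep a b β ψ f coef}

/-- `g` is a `v`-term approximant from `Ψ(Q)`: a linear combination of at most `v` of the
elements `ψ k`, `k ∈ Q`. -/
def IsTermApproximant {ι : Type*} (v : ℕ) (ψ : ι → X) (Q : Finset ι) (g : X) : Prop :=
  ∃ S : Finset ι, S ⊆ Q ∧ S.card ≤ v ∧ ∃ e : ι → ℂ, g = ∑ k ∈ S, e k • ψ k

/-- `g` is a result of `m` iterations of the Weak Chebyshev Greedy Algorithm with weakness
parameter `t`, applied to `r` with respect to the finite system `ψ k`, `k ∈ D`.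
`G i` is the approximant after `i` iterations.  Iteration `i + 1` takes a norming functional `F`
of the residual `r - G i`, picks any `φ i ∈ D` with `|F (ψ (φ i))| ≥ t max_{k ∈ D} |F (ψ k)|`,
and lets `G (i + 1)` be a best approximant of `r` from the linear span of
`ψ (φ 0), …, ψ (φ i)`. -/
def IsWCGAResult {ι : Type*} (t : ℝ) (ψ : ι → X) (D : Finset ι) (r : X) (m : ℕ) (g : X) : Prop :=
  ∃ (φ : ℕ → ι) (G : ℕ → X), G 0 = 0 ∧
    (∀ i < m,
      (φ i ∈ D ∧
        ∃ F : X →L[ℂ] ℂ, ‖F‖ ≤ 1 ∧ F (r - G i) = (‖r - G i‖ : ℂ) ∧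
          ∀ k ∈ D, t * ‖F (ψ k)‖ ≤ ‖F (ψ (φ i))‖) ∧
      G (i + 1) ∈ Submodule.span ℂ {x | ∃ l ≤ i, x = ψ (φ l)} ∧
      ∀ y ∈ Submodule.span ℂ {x | ∃ l ≤ i, x = ψ (φ l)}, ‖r - G (i + 1)‖ ≤ ‖r - y‖) ∧
    G m = g

/-- `I` consists of the `m` indices in `D` with the largest coefficients in absolute value
(of all indices in `D`, if there are fewer than `m`), ties being broken in any way. -/
def IsLargest {ι : Type*} (coef : ι → ℂ) (D : Finset ι) (m : ℕ) (I : Finset ι) : Prop :=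
  I ⊆ D ∧ I.card = min m D.card ∧ ∀ k ∈ I, ∀ l ∈ D, l ∉ I → ‖coef l‖ ≤ ‖coef k‖

/-- The numerical parameters of the layerwise greedy method: the weakness parameter `t`, the
number `J` of layers that are used, and for each layer `j < J` the number `keep j` of largest
coefficients that are kept and the number `steps j` of iterations of the Weak Chebyshev Greedy
Algorithm that are made. -/
structure GreedyMethod where
  t : ℝ
  t_pos : 0 < t
  t_le_one : t ≤ 1
  J : ℕ
  keep : ℕ → ℕ
  steps : ℕ → ℕ

/-- The greedy method `M`, run on the expansion `∑ coef k • ψ k`, can return `g`.  In each layer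
`j < J` it keeps the terms with the `keep j` largest coefficients, and applies `steps j`
iterations of the Weak Chebyshev Greedy Algorithm, with respect to the elements `ψ k` of that
layer, to the sum of the remaining terms of the layer; it returns the sum of everything obtained.
The only freedom in a run is in breaking ties and in the choices that the Weak Chebyshev Greedy
Algorithm leaves open. -/
def GreedyMethod.Returns {d : ℕ} (M : GreedyMethod) (ψ : (Fin d → ℤ) → X)
    (coef : (Fin d → ℤ) → ℂ) (g : X) : Prop :=
  ∃ (I : ℕ → Finset (Fin d → ℤ)) (h : ℕ → X),
    (∀ j < M.J, IsLargest coef (layer d j) (M.keep j) (I j) ∧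
      IsWCGAResult M.t ψ (layer d j) (∑ k ∈ layer d j \ I j, coef k • ψ k) (M.steps j) (h j)) ∧
    g = ∑ j ∈ Finset.range M.J, ((∑ k ∈ I j, coef k • ψ k) + h j)

end NormedSpace

end MixedGreedy

end

/-!
Write `q = min(p, 2)`. The space `L_p` is smooth of power type `q`:
`‖x + y‖ + ‖x - y‖ ≤ 2 + 2 K ‖y‖^q` for unit vectors `x`, with `K` depending on `p` only. In such
a space a step of the Weak Chebyshev Greedy Algorithm lowers the norm `δ` of the residual of an
element of `B` times the absolutely convex hull of the dictionary to at most
`δ (1 - κ (δ / B)^(q/(q-1)))`, and this recursion gives the error `O(B m^(-(1-1/q)))` after `m`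
iterations. Keeping first the `m` largest coefficients makes `B` at most `m^(1-1/β)` times the
`ℓ_β`-norm of the coefficients, so that `2 m` terms approximate a layer with the error
`O(m^(-α))` relative to its `A_β`-quasinorm, where `α = 1/β - 1/q`.

Choose `n` with `2^n n^(d-1) ≍ v`, so that all of the layers below `n` fit into half of the budget
and are reproduced exactly. The layer `n + i` gets the budget `m_i ≍ v 2^(-a i/(2 α))`: the budgets
sum to at most `v / 2`, while the errors, of order `v^(-α) 2^(a i/2) 2^(-a (n+i)) (n+i)^((d-1) b)`,
are summable and add up to a multiple of `v^(-α) 2^(-a n) n^((d-1) b)`. The budget vanishes once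
`i` exceeds a multiple of `log v`, and this keeps `|Q|` polynomial in `v`.
-/

namespace MixedGreedy

/-- The modulus of smoothness `ρ(u) = sup_{‖x‖ = 1, ‖y‖ = u} (‖x + y‖ + ‖x - y‖) / 2 - 1` of `X`
has power type `q` with constant `K`, that is, `ρ(u) ≤ K u^q` for all `u`. -/
def HasPowerSmoothness (X : Type*) [NormedAddCommGroup X] (K q : ℝ) : Prop :=
  ∀ x y : X, ‖x‖ = 1 → ‖x + y‖ + ‖x - y‖ ≤ 2 + 2 * K * ‖y‖ ^ q

theorem HasPowerSmoothness.mono {X : Type*} [NormedAddCommGroup X] {K K' q : ℝ}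
    (hX : HasPowerSmoothness X K q) (hK : K ≤ K') : HasPowerSmoothness X K' q := fun x y hx =>
  (hX x y hx).trans (by gcongr)

theorem exp_mul_le_one_add {t x : ℝ} (h0 : 0 ≤ x) (h1 : x ≤ 1) :
    Real.exp (t * x) ≤ 1 + (Real.exp t - 1) * x := by
  have h := convexOn_exp.2 (Set.mem_univ 0) (Set.mem_univ t) (sub_nonneg.2 h1) h0
    (sub_add_cancel 1 x)
  simp only [smul_eq_mul, mul_zero, zero_add, Real.exp_zero, mul_one] at h
  rw [mul_comm t x]
  linarith

theorem one_add_rpow_add_one_sub_rpow_le {x s : ℝ} (hx : |x| ≤ 1) (hs : 0 ≤ s) :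
    (1 + x) ^ s + (1 - x) ^ s ≤ 2 * (1 + (Real.exp (s / 2) - 1) * x ^ 2) ^ s := by
  have rpow_le_exp {y : ℝ} (hy : |y| ≤ 1) : (1 + y) ^ s ≤ Real.exp (s * y) := by
    rw [mul_comm, Real.exp_mul]
    exact Real.rpow_le_rpow (by linarith [neg_le_of_abs_le hy])
      (by linarith [Real.add_one_le_exp y]) hs
  calc (1 + x) ^ s + (1 - x) ^ s
      ≤ Real.exp (s * x) + Real.exp (-(s * x)) := by
        rw [sub_eq_add_neg, ← mul_neg]
        exact add_le_add (rpow_le_exp hx) (rpow_le_exp (by rwa [abs_neg]))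
    _ = 2 * Real.cosh (s * x) := by rw [Real.cosh_eq]; ring
    _ ≤ 2 * Real.exp ((s * x) ^ 2 / 2) := by gcongr; exact Real.cosh_le_exp_half_sq _
    _ = 2 * Real.exp (s / 2 * x ^ 2) ^ s := by rw [← Real.exp_mul]; ring_nf
    _ ≤ _ := by
      gcongr
      exact exp_mul_le_one_add (sq_nonneg x) ((sq_le_one_iff_abs_le_one x).2 hx)

theorem add_rpow_add_sub_rpow_le_add_sq_div {A B s : ℝ} (hB : |B| ≤ A) (hs : 0 ≤ s) :
    (A + B) ^ s + (A - B) ^ s ≤ 2 * (A + (Real.exp (s / 2) - 1) * (B ^ 2 / A)) ^ s := by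
  rcases ((abs_nonneg B).trans hB).eq_or_lt with rfl | hA
  · simp only [abs_nonpos_iff.1 hB, add_zero, sub_zero, div_zero, mul_zero, two_mul, le_refl]
  obtain ⟨x, rfl⟩ : ∃ x, B = A * x := ⟨B / A, by field_simp⟩
  have hx : |x| ≤ 1 := by rwa [abs_mul, abs_of_pos hA, mul_le_iff_le_one_right hA] at hB
  have hexp : 0 ≤ Real.exp (s / 2) - 1 := by linarith [Real.add_one_le_exp (s / 2)]
  rw [show A + A * x = A * (1 + x) by ring, show A - A * x = A * (1 - x) by ring,
    show A + (Real.exp (s / 2) - 1) * ((A * x) ^ 2 / A) =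
      A * (1 + (Real.exp (s / 2) - 1) * x ^ 2) by field_simp,
    Real.mul_rpow hA.le (by linarith [neg_le_of_abs_le hx]),
    Real.mul_rpow hA.le (by linarith [le_of_abs_le hx]), Real.mul_rpow hA.le (by positivity),
    ← mul_add, mul_left_comm]
  gcongr
  exact one_add_rpow_add_one_sub_rpow_le hx hs

theorem add_rpow_add_sub_rpow_le_of_le_one {A B s : ℝ} (hB : |B| ≤ A) (hs : 0 ≤ s) (hs1 : s ≤ 1) :
    (A + B) ^ s + (A - B) ^ s ≤ 2 * A ^ s := by
  have h := (Real.concaveOn_rpow hs hs1).2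
    (show A + B ∈ Set.Ici 0 by simpa using by linarith [neg_le_of_abs_le hB])
    (show A - B ∈ Set.Ici 0 by simpa using by linarith [le_of_abs_le hB])
    (by norm_num : (0 : ℝ) ≤ 1 / 2) (by norm_num : (0 : ℝ) ≤ 1 / 2) (by norm_num)
  simp only [smul_eq_mul] at h
  rw [show 1 / 2 * (A + B) + 1 / 2 * (A - B) = A by ring] at h
  linarith

theorem add_le_two_mul_of_rpow_add_rpow_le {x y M P : ℝ} (hx : 0 ≤ x) (hy : 0 ≤ y) (hM : 0 ≤ M)
    (hP : 1 ≤ P) (h : x ^ P + y ^ P ≤ 2 * M ^ P) : x + y ≤ 2 * M := by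
  have hconv := (convexOn_rpow hP).2 hx hy (by norm_num : (0 : ℝ) ≤ 1 / 2)
    (by norm_num : (0 : ℝ) ≤ 1 / 2) (by norm_num)
  simp only [smul_eq_mul] at hconv
  have : 1 / 2 * x + 1 / 2 * y ≤ M :=
    (Real.rpow_le_rpow_iff (by positivity) hM (zero_lt_one.trans_le hP)).1 (by linarith)
  linarith

theorem add_mul_rpow_le {x z l s : ℝ} (hx : 0 ≤ x) (hz : 0 ≤ z) (hl : 0 ≤ l) (hs : 1 ≤ s) :
    (x + l * z) ^ s ≤ (1 + l) ^ (s - 1) * (x ^ s + l * z ^ s) := by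
  have hl1 : 0 < 1 + l := by linarith
  have h := (convexOn_rpow hs).2 hx hz (by positivity : 0 ≤ 1 / (1 + l))
    (by positivity : 0 ≤ l / (1 + l)) (by field_simp)
  simp only [smul_eq_mul] at h
  calc (x + l * z) ^ s = (1 + l) ^ s * (1 / (1 + l) * x + l / (1 + l) * z) ^ s := by
        rw [← Real.mul_rpow hl1.le (by positivity)]; field_simp
    _ ≤ (1 + l) ^ s * (1 / (1 + l) * x ^ s + l / (1 + l) * z ^ s) := by gcongr
    _ = (1 + l) ^ (s - 1) * (x ^ s + l * z ^ s) := by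
        rw [Real.rpow_sub_one hl1.ne']; field_simp

theorem norm_rpow_eq_sq_rpow {E : Type*} [NormedAddCommGroup E] (w : E) (P : ℝ) :
    ‖w‖ ^ P = (‖w‖ ^ 2) ^ (P / 2) := by
  rw [← Real.rpow_natCast_mul (norm_nonneg w)]; congr 1; push_cast; ring

section InnerProductSpace

variable {E : Type*} [NormedAddCommGroup E] [InnerProductSpace ℝ E] {P : ℝ}

theorem abs_two_mul_inner_le (w z : E) : |2 * inner ℝ w z| ≤ ‖w‖ ^ 2 + ‖z‖ ^ 2 := by
  rw [abs_mul, abs_two]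
  linarith [abs_real_inner_le_norm w z, two_mul_le_add_sq ‖w‖ ‖z‖]

theorem norm_add_rpow_add_norm_sub_rpow (w z : E) (P : ℝ) : ‖w + z‖ ^ P + ‖w - z‖ ^ P =
    (‖w‖ ^ 2 + ‖z‖ ^ 2 + 2 * inner ℝ w z) ^ (P / 2) +
      (‖w‖ ^ 2 + ‖z‖ ^ 2 - 2 * inner ℝ w z) ^ (P / 2) := by
  rw [norm_rpow_eq_sq_rpow (w + z), norm_rpow_eq_sq_rpow (w - z), norm_add_sq_real,
    norm_sub_sq_real]
  ring_nf

theorem norm_add_rpow_add_norm_sub_rpow_le_of_le_two (hP : 0 ≤ P) (hP2 : P ≤ 2) (w z : E) :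
    ‖w + z‖ ^ P + ‖w - z‖ ^ P ≤ 2 * ‖w‖ ^ P + 2 * ‖z‖ ^ P := by
  rw [norm_add_rpow_add_norm_sub_rpow, norm_rpow_eq_sq_rpow w, norm_rpow_eq_sq_rpow z, ← mul_add]
  refine (add_rpow_add_sub_rpow_le_of_le_one (abs_two_mul_inner_le w z) (by linarith)
    (by linarith)).trans ?_
  gcongr
  exact Real.rpow_add_le_add_rpow (by positivity) (by positivity) (by linarith) (by linarith)

theorem norm_add_rpow_add_norm_sub_rpow_le_sq (hP : 0 ≤ P) (w z : E) :
    ‖w + z‖ ^ P + ‖w - z‖ ^ P ≤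
      2 * (‖w‖ ^ 2 + 4 * Real.exp (P / 4) * ‖z‖ ^ 2) ^ (P / 2) := by
  rw [norm_add_rpow_add_norm_sub_rpow]
  refine (add_rpow_add_sub_rpow_le_add_sq_div (abs_two_mul_inner_le w z) (by positivity)).trans ?_
  have hexp : 0 ≤ Real.exp (P / 2 / 2) - 1 := by linarith [Real.add_one_le_exp (P / 2 / 2)]
  have hinner : (2 * inner ℝ w z) ^ 2 / (‖w‖ ^ 2 + ‖z‖ ^ 2) ≤ 4 * ‖z‖ ^ 2 := by
    refine div_le_of_le_mul₀ (by positivity) (by positivity) ?_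
    have := sq_le_sq' (neg_le_of_abs_le (abs_real_inner_le_norm w z)) (real_inner_le_norm w z)
    nlinarith [sq_nonneg (‖z‖ ^ 2)]
  gcongr 2 * ?_ ^ _
  calc _ ≤ ‖w‖ ^ 2 + ‖z‖ ^ 2 + (Real.exp (P / 2 / 2) - 1) * (4 * ‖z‖ ^ 2) := by gcongr
    _ ≤ ‖w‖ ^ 2 + 4 * Real.exp (P / 4) * ‖z‖ ^ 2 := by
      rw [show P / 2 / 2 = P / 4 by ring]; linarith [sq_nonneg ‖z‖]

/-- The scale `τ` is left free so that in `L_p` it can be taken to be the norm of `z`. -/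
theorem norm_add_rpow_add_norm_sub_rpow_le_of_two_le (hP : 2 ≤ P) {τ : ℝ} (hτ : 0 < τ) (w z : E) :
    ‖w + z‖ ^ P + ‖w - z‖ ^ P ≤
      2 * (1 + 4 * Real.exp (P / 4) * τ ^ 2) ^ (P / 2 - 1) * ‖w‖ ^ P +
        2 * (1 + 4 * Real.exp (P / 4) * τ ^ 2) ^ (P / 2 - 1) *
          (4 * Real.exp (P / 4) * τ ^ 2 / τ ^ P) * ‖z‖ ^ P := by
  set l := 4 * Real.exp (P / 4) * τ ^ 2 with hl
  have h := add_mul_rpow_le (sq_nonneg ‖w‖) (sq_nonneg (‖z‖ / τ)) (by positivity : 0 ≤ l)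
    (by linarith : 1 ≤ P / 2)
  have hz : l * (‖z‖ / τ) ^ 2 = 4 * Real.exp (P / 4) * ‖z‖ ^ 2 := by rw [hl]; field_simp
  have hzP : ((‖z‖ / τ) ^ 2) ^ (P / 2) = ‖z‖ ^ P / τ ^ P := by
    rw [← Real.rpow_natCast_mul (by positivity), ← Real.div_rpow (norm_nonneg z) hτ.le]
    congr 1; push_cast; ring
  rw [hz, hzP, ← norm_rpow_eq_sq_rpow] at h
  refine (norm_add_rpow_add_norm_sub_rpow_le_sq (by linarith) w z).trans
    ((mul_le_mul_of_nonneg_left h zero_le_two).trans_eq ?_)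
  ring

end InnerProductSpace

section Lp

variable {Ω : Type*} [MeasurableSpace Ω] {μ : Measure Ω} {E : Type*} [NormedAddCommGroup E]
  {p : ℝ≥0∞} [Fact (1 ≤ p)]

theorem norm_rpow_eq_integral (hp : p ≠ ∞) (x : Lp E p μ) :
    ‖x‖ ^ p.toReal = ∫ ω, ‖x ω‖ ^ p.toReal ∂μ := by
  have hp0 : p ≠ 0 := (zero_lt_one.trans_le Fact.out).ne'
  have hP : 0 < p.toReal := ENNReal.toReal_pos hp0 hp
  have hnorm : 0 ≤ ∫ ω, ‖x ω‖ ^ p.toReal ∂μ := integral_nonneg fun ω => by positivity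
  rw [Lp.norm_def, (Lp.memLp x).eLpNorm_eq_integral_rpow_norm hp0 hp,
    ENNReal.toReal_ofReal (by positivity), Real.rpow_inv_rpow hnorm hP.ne']

theorem norm_add_rpow_add_norm_sub_rpow_le_Lp (hp : p ≠ ∞) {M N : ℝ}
    (hE : ∀ w z : E, ‖w + z‖ ^ p.toReal + ‖w - z‖ ^ p.toReal ≤
      M * ‖w‖ ^ p.toReal + N * ‖z‖ ^ p.toReal) (x y : Lp E p μ) :
    ‖x + y‖ ^ p.toReal + ‖x - y‖ ^ p.toReal ≤ M * ‖x‖ ^ p.toReal + N * ‖y‖ ^ p.toReal := by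
  have hnorm (x : Lp E p μ) : Integrable (fun ω => ‖x ω‖ ^ p.toReal) μ :=
    (Lp.memLp x).integrable_norm_rpow (zero_lt_one.trans_le Fact.out).ne' hp
  simp only [norm_rpow_eq_integral hp]
  rw [← integral_add (hnorm _) (hnorm _), ← integral_const_mul, ← integral_const_mul,
    ← integral_add ((hnorm x).const_mul M) ((hnorm y).const_mul N)]
  refine integral_mono_ae ((hnorm _).add (hnorm _))
    (((hnorm x).const_mul M).add ((hnorm y).const_mul N)) ?_
  filter_upwards [Lp.coeFn_add x y, Lp.coeFn_sub x y] with ω hadd hsub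
  rw [hadd, hsub]
  exact hE _ _

variable (μ E) [InnerProductSpace ℝ E]

theorem hasPowerSmoothness_Lp_of_le_two (hp : p.toReal ≤ 2) (hp' : p ≠ ∞) :
    HasPowerSmoothness (Lp E p μ) 1 p.toReal := by
  intro x y hx
  have hP : 1 ≤ p.toReal := by
    simpa using ENNReal.toReal_mono hp' (Fact.out : 1 ≤ p)
  have h := norm_add_rpow_add_norm_sub_rpow_le_Lp hp'
    (norm_add_rpow_add_norm_sub_rpow_le_of_le_two (by linarith) hp) x y
  rw [hx, Real.one_rpow, mul_one] at h
  have hy : 1 ≤ 1 + ‖y‖ ^ p.toReal := le_add_of_nonneg_right (by positivity)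
  have := add_le_two_mul_of_rpow_add_rpow_le (norm_nonneg (x + y)) (norm_nonneg (x - y))
    (zero_le_one.trans hy) hP (by linarith [Real.self_le_rpow_of_one_le hy hP])
  linarith

theorem hasPowerSmoothness_Lp_of_two_le (hp : 2 ≤ p.toReal) (hp' : p ≠ ∞) :
    HasPowerSmoothness (Lp E p μ) (4 * Real.exp (p.toReal / 4)) 2 := by
  intro x y hx
  rcases eq_or_ne y 0 with rfl | hy
  · rw [add_zero, sub_zero, norm_zero, Real.zero_rpow two_ne_zero, hx]; norm_num
  have hy0 : 0 < ‖y‖ := norm_pos_iff.2 hy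
  have h := norm_add_rpow_add_norm_sub_rpow_le_Lp hp'
    (norm_add_rpow_add_norm_sub_rpow_le_of_two_le hp hy0) x y
  set l := 4 * Real.exp (p.toReal / 4) * ‖y‖ ^ 2
  have hl0 : 0 < 1 + l := by positivity
  have hl1 : 1 ≤ 1 + l := le_add_of_nonneg_right (by positivity)
  rw [hx, Real.one_rpow, mul_one, mul_assoc _ (l / _),
    div_mul_cancel₀ l (Real.rpow_pos_of_pos hy0 _).ne', ← mul_one_add, mul_assoc,
    ← Real.rpow_add_one hl0.ne', sub_add_cancel] at h
  have hrpow : (1 + l) ^ (p.toReal / 2) ≤ (1 + l) ^ p.toReal :=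
    Real.rpow_le_rpow_of_exponent_le hl1 (by linarith)
  have := add_le_two_mul_of_rpow_add_rpow_le (norm_nonneg _) (norm_nonneg _) hl0.le
    (by linarith) (h.trans (mul_le_mul_of_nonneg_left hrpow zero_le_two))
  rw [Real.rpow_two]
  linarith

end Lp

theorem exists_hasPowerSmoothness_Lp (E : Type*) [NormedAddCommGroup E] [InnerProductSpace ℝ E]
    (p : ℝ≥0∞) [Fact (1 ≤ p)] (hp : p ≠ ∞) :
    ∃ K : ℝ, ∀ (Ω : Type*) [MeasurableSpace Ω] (μ : Measure Ω),
      HasPowerSmoothness (Lp E p μ) K (min p.toReal 2) := by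
  rcases le_total p.toReal 2 with h | h
  · exact ⟨1, fun Ω _ μ => by rw [min_eq_left h]; exact hasPowerSmoothness_Lp_of_le_two μ E h hp⟩
  · exact ⟨_, fun Ω _ μ => by rw [min_eq_right h]; exact hasPowerSmoothness_Lp_of_two_le μ E h hp⟩

section BestApproximation

variable {X : Type*} [NormedAddCommGroup X] [NormedSpace ℂ X] {K q : ℝ} {L : Submodule ℂ X}
  {r g x z : X} {F : X →L[ℂ] ℂ}

/-- `g` is a best approximation of `r` from the subspace `L`. -/
def IsBestApprox (L : Submodule ℂ X) (r g : X) : Prop :=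
  g ∈ L ∧ ∀ y ∈ L, ‖r - g‖ ≤ ‖r - y‖

theorem isBestApprox_bot_iff : IsBestApprox ⊥ r g ↔ g = 0 := by
  simp only [IsBestApprox, Submodule.mem_bot, forall_eq, and_iff_left_iff_imp]
  rintro rfl
  rfl

theorem IsBestApprox.norm_sub_le_norm (h : IsBestApprox L r g) : ‖r - g‖ ≤ ‖r‖ := by
  simpa only [sub_zero] using h.2 0 L.zero_mem

theorem exists_isBestApprox (L : Submodule ℂ X) [FiniteDimensional ℂ L] (r : X) :
    ∃ g, IsBestApprox L r g := by
  have : ProperSpace L := FiniteDimensional.proper ℂ L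
  have hlim : Filter.Tendsto (fun y : L => ‖r - y‖) (Filter.cocompact L) Filter.atTop := by
    refine Filter.tendsto_atTop_mono (f := fun y : L => ‖y‖ - ‖r‖) (fun y => ?_)
      (Filter.tendsto_atTop_add_const_right _ _ tendsto_norm_cocompact_atTop)
    rw [norm_sub_rev r]
    exact norm_sub_norm_le (y : X) r
  obtain ⟨g, hg⟩ := Continuous.exists_forall_le
    (f := fun y : L => ‖r - y‖) (by fun_prop) hlim
  exact ⟨g, g.2, fun y hy => hg ⟨y, hy⟩⟩

theorem HasPowerSmoothness.norm_sub_smul_le (hX : HasPowerSmoothness X K q) (hF : ‖F‖ ≤ 1)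
    (hFx : F x = (‖x‖ : ℂ)) (z : X) :
    ‖x - (‖x‖ : ℂ) • z‖ ≤ ‖x‖ * (1 - (F z).re + 2 * K * ‖z‖ ^ q) := by
  rcases eq_or_ne x 0 with rfl | hx
  · simp
  have hx0 : (‖x‖ : ℂ) ≠ 0 := by exact_mod_cast norm_ne_zero_iff.2 hx
  obtain ⟨e, he⟩ : ∃ e, x = (‖x‖ : ℂ) • e := ⟨(‖x‖ : ℂ)⁻¹ • x, (smul_inv_smul₀ hx0 x).symm⟩
  have hFe : F e = 1 := by
    rw [he, map_smul, smul_eq_mul, ← he] at hFx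
    exact mul_left_cancel₀ hx0 (by rw [hFx, mul_one])
  have he1 : ‖e‖ = 1 := by
    have h := congrArg norm he
    rw [norm_smul, Complex.norm_real, norm_norm] at h
    exact mul_left_cancel₀ (norm_ne_zero_iff.2 hx) (by rw [← h, mul_one])
  have hlower : 1 + (F z).re ≤ ‖e + z‖ := by
    calc 1 + (F z).re = (F (e + z)).re := by rw [map_add, hFe, Complex.add_re, Complex.one_re]
      _ ≤ ‖F (e + z)‖ := Complex.re_le_norm _
      _ ≤ ‖e + z‖ := F.le_of_opNorm_le_of_le hF le_rfl |>.trans_eq (one_mul _)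
  have hxz : x - (‖x‖ : ℂ) • z = (‖x‖ : ℂ) • (e - z) := by rw [smul_sub, ← he]
  rw [hxz, norm_smul, Complex.norm_real, norm_norm]
  gcongr
  linarith [hX e z he1]

theorem HasPowerSmoothness.re_apply_nonpos (hX : HasPowerSmoothness X K q) (hq : 1 < q)
    (hF : ‖F‖ ≤ 1) (hFx : F x = (‖x‖ : ℂ)) (hx : x ≠ 0) (hbest : ∀ y ∈ L, ‖x‖ ≤ ‖x - y‖)
    {y : X} (hy : y ∈ L) : (F y).re ≤ 0 := by
  have hlim : Filter.Tendsto (fun u : ℝ => 2 * K * ‖y‖ ^ q * u ^ (q - 1))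
      (nhdsWithin 0 (Set.Ioi 0)) (nhds 0) := by
    have h : ContinuousAt (fun u : ℝ => 2 * K * ‖y‖ ^ q * u ^ (q - 1)) 0 :=
      continuousAt_const.mul (Real.continuousAt_rpow_const 0 (q - 1) (Or.inr (by linarith)))
    have h0 := h.tendsto
    rw [Real.zero_rpow (by linarith), mul_zero] at h0
    exact h0.mono_left nhdsWithin_le_nhds
  refine ge_of_tendsto hlim ?_
  filter_upwards [self_mem_nhdsWithin] with u (hu : 0 < u)
  have hdescent := (hbest _ (L.smul_mem (‖x‖ : ℂ) (L.smul_mem (u : ℂ) hy))).trans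
    (hX.norm_sub_smul_le hF hFx ((u : ℂ) • y))
  have h1 := (le_mul_iff_one_le_right (norm_pos_iff.2 hx)).1 hdescent
  rw [map_smul, smul_eq_mul, Complex.re_ofReal_mul, norm_smul, Complex.norm_real,
    Real.norm_of_nonneg hu.le, Real.mul_rpow hu.le (norm_nonneg y)] at h1
  refine le_of_mul_le_mul_left ?_ hu
  calc u * (F y).re ≤ 2 * K * (u ^ q * ‖y‖ ^ q) := by linarith
    _ = u * (2 * K * ‖y‖ ^ q * u ^ (q - 1)) := by rw [Real.rpow_sub_one hu.ne']; field_simp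

theorem HasPowerSmoothness.apply_eq_zero (hX : HasPowerSmoothness X K q) (hq : 1 < q)
    (hF : ‖F‖ ≤ 1) (hFx : F x = (‖x‖ : ℂ)) (hx : x ≠ 0) (hbest : ∀ y ∈ L, ‖x‖ ≤ ‖x - y‖)
    {y : X} (hy : y ∈ L) : F y = 0 := by
  have h := hX.re_apply_nonpos hq hF hFx hx hbest (L.smul_mem (starRingEnd ℂ (F y)) hy)
  rw [map_smul, smul_eq_mul, Complex.conj_mul', ← Complex.ofReal_pow, Complex.ofReal_re] at h
  exact norm_eq_zero.1 (pow_eq_zero_iff two_ne_zero |>.1 (h.antisymm (sq_nonneg _)))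

/-- The factor `κ` in the decrease `‖x - c z‖ ≤ ‖x‖ (1 - κ δ^(q / (q - 1)))` that a norming
functional `F` of `x` with `|F z| ≥ δ` guarantees along `z`. It is what the step
`u = (δ / (4 K))^(1 / (q - 1))` gives in `1 - u δ + 2 K u^q`. -/
noncomputable def descentRate (K q : ℝ) : ℝ := (4 * K)⁻¹ ^ (1 / (q - 1)) / 2

theorem descentRate_pos (hK : 0 < K) : 0 < descentRate K q := by
  unfold descentRate; positivity

theorem descentRate_le_one (hK : 1 ≤ K) (hq : 1 < q) : descentRate K q ≤ 1 := by
  have h : (4 * K)⁻¹ ^ (1 / (q - 1)) ≤ 1 :=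
    Real.rpow_le_one (by positivity) (inv_le_one_of_one_le₀ (by linarith))
      (one_div_nonneg.2 (by linarith))
  unfold descentRate
  linarith

theorem exists_step_eq_descentRate (hK : 0 < K) (hq : 1 < q) {δ : ℝ} (hδ : 0 ≤ δ) :
    ∃ u, 0 ≤ u ∧ 1 - u * δ + 2 * K * u ^ q = 1 - descentRate K q * δ ^ (q / (q - 1)) := by
  have hq1 : 0 < q - 1 := by linarith
  have hinv : 0 < 1 / (q - 1) := by positivity
  have hexp : q / (q - 1) = 1 / (q - 1) + 1 := by field_simp; ring
  set u := (δ * (4 * K)⁻¹) ^ (1 / (q - 1)) with hu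
  have hu0 : 0 ≤ u := by positivity
  have huq : u ^ q = δ * (4 * K)⁻¹ * u := by
    calc u ^ q = u ^ ((q - 1) + 1) := by rw [sub_add_cancel]
      _ = u ^ (q - 1) * u := by
        rw [Real.rpow_add_of_nonneg hu0 hq1.le zero_le_one, Real.rpow_one]
      _ = δ * (4 * K)⁻¹ * u := by
        rw [hu, ← Real.rpow_mul (by positivity), one_div_mul_cancel hq1.ne', Real.rpow_one]
  refine ⟨u, hu0, ?_⟩
  rw [huq, hexp, Real.rpow_add_of_nonneg hδ hinv.le zero_le_one, Real.rpow_one, hu,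
    Real.mul_rpow hδ (by positivity), descentRate]
  field_simp
  ring

theorem HasPowerSmoothness.exists_norm_sub_smul_le (hX : HasPowerSmoothness X K q) (hK : 0 < K)
    (hq : 1 < q) (hF : ‖F‖ ≤ 1) (hFx : F x = (‖x‖ : ℂ)) (hz : ‖z‖ ≤ 1) {δ : ℝ} (hδ : 0 ≤ δ)
    (hFz : δ ≤ ‖F z‖) :
    ∃ c : ℂ, ‖x - c • z‖ ≤ ‖x‖ * (1 - descentRate K q * δ ^ (q / (q - 1))) := by
  obtain ⟨w, hw, hwF⟩ := RCLike.exists_norm_eq_mul_self (F z)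
  obtain ⟨u, hu, hrate⟩ := exists_step_eq_descentRate hK hq hδ
  have hnorm : ‖((u : ℂ) * w) • z‖ ≤ u := by
    rw [norm_smul, norm_mul, Complex.norm_real, Real.norm_of_nonneg hu, hw, mul_one]
    exact mul_le_of_le_one_right hu hz
  have hre : (F (((u : ℂ) * w) • z)).re = u * ‖F z‖ := by
    rw [map_smul, smul_eq_mul, mul_assoc, ← hwF, Complex.re_ofReal_mul]
    simp
  refine ⟨‖x‖ * (u * w), ?_⟩
  rw [mul_smul, ← hrate]
  refine (hX.norm_sub_smul_le hF hFx _).trans ?_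
  rw [hre]
  gcongr

end BestApproximation

section WCGA

variable {X : Type*} [NormedAddCommGroup X] [NormedSpace ℂ X] {K q t : ℝ} {ι : Type*}
  {ψ : ι → X} {D E : Finset ι} {coef : ι → ℂ} {m : ℕ} {r g x : X}

/-- `k` is a choice that the Weak Chebyshev Greedy Algorithm with weakness parameter `t` allows
when the residual is `x`. -/
def IsGreedyChoice (t : ℝ) (ψ : ι → X) (D : Finset ι) (x : X) (k : ι) : Prop :=
  k ∈ D ∧ ∃ F : X →L[ℂ] ℂ, ‖F‖ ≤ 1 ∧ F x = (‖x‖ : ℂ) ∧ ∀ l ∈ D, t * ‖F (ψ l)‖ ≤ ‖F (ψ k)‖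

/-- The span of the first `n` elements chosen by the Weak Chebyshev Greedy Algorithm. -/
def greedySpan (ψ : ι → X) (φ : ℕ → ι) (n : ℕ) : Submodule ℂ X :=
  Submodule.span ℂ ((fun l => ψ (φ l)) '' Set.Iio n)

instance (ψ : ι → X) (φ : ℕ → ι) (n : ℕ) : FiniteDimensional ℂ (greedySpan ψ φ n) :=
  FiniteDimensional.span_of_finite ℂ ((Set.finite_Iio n).image _)

theorem greedySpan_zero (ψ : ι → X) (φ : ℕ → ι) : greedySpan ψ φ 0 = ⊥ := by
  simp [greedySpan]

theorem greedySpan_succ (ψ : ι → X) (φ : ℕ → ι) (n : ℕ) :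
    greedySpan ψ φ (n + 1) = Submodule.span ℂ {x | ∃ l ≤ n, x = ψ (φ l)} := by
  unfold greedySpan
  congr 1
  ext x
  simp [eq_comm]

theorem greedySpan_mono (ψ : ι → X) (φ : ℕ → ι) {n n' : ℕ} (h : n ≤ n') :
    greedySpan ψ φ n ≤ greedySpan ψ φ n' :=
  Submodule.span_mono (Set.image_mono (Set.Iio_subset_Iio h))

theorem mem_greedySpan_succ (ψ : ι → X) (φ : ℕ → ι) (n : ℕ) :
    ψ (φ n) ∈ greedySpan ψ φ (n + 1) :=
  Submodule.subset_span ⟨n, Nat.lt_succ_self n, rfl⟩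

theorem greedySpan_congr (ψ : ι → X) {φ φ' : ℕ → ι} {n : ℕ} (h : ∀ l < n, φ l = φ' l) :
    greedySpan ψ φ n = greedySpan ψ φ' n :=
  congrArg (Submodule.span ℂ) (Set.image_congr fun l hl => congrArg ψ (h l hl))

theorem isWCGAResult_iff : IsWCGAResult t ψ D r m g ↔ ∃ (φ : ℕ → ι) (G : ℕ → X),
    (∀ i ≤ m, IsBestApprox (greedySpan ψ φ i) r (G i)) ∧
      (∀ i < m, IsGreedyChoice t ψ D (r - G i) (φ i)) ∧ G m = g := by
  simp only [IsWCGAResult, ← greedySpan_succ]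
  refine exists_congr fun φ => exists_congr fun G => ⟨?_, ?_⟩
  · rintro ⟨hG, hstep, hm⟩
    refine ⟨?_, fun i hi => (hstep i hi).1, hm⟩
    rintro (_ | i) hi
    · rwa [greedySpan_zero, isBestApprox_bot_iff]
    · exact (hstep i hi).2
  · rintro ⟨hbest, hchoice, hm⟩
    have h0 := hbest 0 (Nat.zero_le m)
    rw [greedySpan_zero, isBestApprox_bot_iff] at h0
    exact ⟨h0, fun i hi => ⟨hchoice i hi, hbest (i + 1) hi⟩, hm⟩

theorem exists_isGreedyChoice (ht : t ≤ 1) (ψ : ι → X) (hD : D.Nonempty) (x : X) :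
    ∃ k, IsGreedyChoice t ψ D x k := by
  obtain ⟨F, hF, hFx⟩ := exists_dual_vector'' ℂ x
  obtain ⟨k, hk, hmax⟩ := D.exists_max_image (fun k => ‖F (ψ k)‖) hD
  exact ⟨k, hk, F, hF, hFx, fun l hl =>
    (mul_le_of_le_one_left (norm_nonneg _) ht).trans (hmax l hl)⟩

theorem exists_isWCGAResult (ht : t ≤ 1) (ψ : ι → X) (hD : D.Nonempty) (r : X) (m : ℕ) :
    ∃ g, IsWCGAResult t ψ D r m g := by
  classical
  simp only [isWCGAResult_iff]
  induction m with
  | zero =>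
    obtain ⟨k, -⟩ := hD
    refine ⟨0, fun _ => k, fun _ => 0, fun i hi => ?_, fun i hi => absurd hi i.not_lt_zero, rfl⟩
    rw [Nat.le_zero.1 hi, greedySpan_zero, isBestApprox_bot_iff]
  | succ m ih =>
    obtain ⟨-, φ, G, hbest, hchoice, -⟩ := ih
    obtain ⟨k, hk⟩ := exists_isGreedyChoice ht ψ hD (r - G m)
    set φ' := Function.update φ m k with hφ'
    have hspan (i : ℕ) (hi : i ≤ m) : greedySpan ψ φ' i = greedySpan ψ φ i :=
      greedySpan_congr ψ fun l hl => Function.update_of_ne (by omega) _ _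
    obtain ⟨g, hg⟩ := exists_isBestApprox (greedySpan ψ φ' (m + 1)) r
    refine ⟨g, φ', Function.update G (m + 1) g, fun i hi => ?_, fun i hi => ?_,
      Function.update_self ..⟩
    · rcases Nat.le_succ_iff.1 hi with hi | rfl
      · rw [Function.update_of_ne (by omega), hspan i hi]
        exact hbest i hi
      · rwa [Function.update_self]
    · rw [Function.update_of_ne (by omega)]
      rcases Nat.lt_succ_iff_lt_or_eq.1 hi with hi | rfl
      · rw [hφ', Function.update_of_ne (by omega)]
        exact hchoice i hi
      · rwa [hφ', Function.update_self]

theorem norm_sum_smul_le (hψ : ∀ k ∈ E, ‖ψ k‖ ≤ 1) :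
    ‖∑ k ∈ E, coef k • ψ k‖ ≤ ∑ k ∈ E, ‖coef k‖ :=
  norm_sum_le_of_le _ fun k hk => by
    rw [norm_smul]; exact mul_le_of_le_one_right (norm_nonneg _) (hψ k hk)

theorem mul_norm_apply_sum_le (ht : 0 ≤ t) {F : X →L[ℂ] ℂ} {M : ℝ}
    (hM : ∀ k ∈ E, t * ‖F (ψ k)‖ ≤ M) :
    t * ‖F (∑ k ∈ E, coef k • ψ k)‖ ≤ (∑ k ∈ E, ‖coef k‖) * M := by
  rw [map_sum, Finset.sum_mul]
  calc t * ‖∑ k ∈ E, F (coef k • ψ k)‖ ≤ t * ∑ k ∈ E, ‖F (coef k • ψ k)‖ := by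
        gcongr; exact norm_sum_le _ _
    _ = ∑ k ∈ E, ‖coef k‖ * (t * ‖F (ψ k)‖) := by
        rw [Finset.mul_sum]
        exact Finset.sum_congr rfl fun k _ => by rw [map_smul, norm_smul, mul_left_comm]
    _ ≤ ∑ k ∈ E, ‖coef k‖ * M :=
        Finset.sum_le_sum fun k hk => mul_le_mul_of_nonneg_left (hM k hk) (norm_nonneg _)

theorem HasPowerSmoothness.norm_sub_le_of_isGreedyChoice (hX : HasPowerSmoothness X K q)
    (hK : 0 < K) (hq : 1 < q) (ht : 0 ≤ t) (hED : E ⊆ D) (hψ : ∀ k ∈ D, ‖ψ k‖ ≤ 1)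
    {L L' : Submodule ℂ X} (hL : L ≤ L') {g' : X} {k : ι} (hkL : ψ k ∈ L')
    (hg : IsBestApprox L (∑ k ∈ E, coef k • ψ k) g)
    (hg' : IsBestApprox L' (∑ k ∈ E, coef k • ψ k) g')
    (hk : IsGreedyChoice t ψ D (∑ k ∈ E, coef k • ψ k - g) k) :
    ‖∑ k ∈ E, coef k • ψ k - g'‖ ≤ ‖∑ k ∈ E, coef k • ψ k - g‖ * (1 - descentRate K q *
      (t * (‖∑ k ∈ E, coef k • ψ k - g‖ / ∑ k ∈ E, ‖coef k‖)) ^ (q / (q - 1))) := by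
  set r := ∑ k ∈ E, coef k • ψ k
  obtain ⟨hkD, F, hF, hFr, hmax⟩ := hk
  rcases eq_or_ne (r - g) 0 with h0 | h0
  · simpa [h0] using hg'.2 g (hL hg.1)
  have hvan : F g = 0 := hX.apply_eq_zero hq hF hFr h0
    (fun y hy => by rw [sub_sub]; exact hg.2 _ (L.add_mem hg.1 hy)) hg.1
  have hnorm : ‖F r‖ = ‖r - g‖ := by
    rw [← sub_zero (F r), ← hvan, ← map_sub, hFr, Complex.norm_real, norm_norm]
  have hFk : t * (‖r - g‖ / ∑ k ∈ E, ‖coef k‖) ≤ ‖F (ψ k)‖ := by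
    rw [← mul_div_assoc, ← hnorm]
    refine div_le_of_le_mul₀ (by positivity) (norm_nonneg _) ?_
    rw [mul_comm ‖F (ψ k)‖]
    exact mul_norm_apply_sum_le ht fun l hl => hmax l (hED hl)
  obtain ⟨c, hc⟩ := hX.exists_norm_sub_smul_le hK hq hF hFr (hψ k hkD) (by positivity) hFk
  refine le_trans ?_ hc
  rw [sub_sub]
  exact hg'.2 _ (L'.add_mem (hL hg.1) (L'.smul_mem c hkL))

theorem rpow_mul_one_add_le_one_of_recursion {κ s : ℝ} (hκ : 0 ≤ κ) (hκ1 : κ ≤ 1) (hs : 1 ≤ s)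
    {δ : ℕ → ℝ} {m : ℕ} (h0 : ∀ i ≤ m, 0 ≤ δ i) (h1 : δ 0 ≤ 1)
    (hrec : ∀ i < m, δ (i + 1) ≤ δ i * (1 - κ * δ i ^ s)) : δ m ^ s * (1 + κ * m) ≤ 1 := by
  induction m with
  | zero => simpa using Real.rpow_le_one (h0 0 le_rfl) h1 (by linarith)
  | succ m ih =>
    have ih := ih (fun i hi => h0 i (by omega)) fun i hi => hrec i (by omega)
    have hδ : 0 ≤ δ m := h0 m m.le_succ
    set y := δ m ^ s
    have hy0 : 0 ≤ y := Real.rpow_nonneg hδ s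
    have hκm : 0 ≤ κ * m := by positivity
    have hy1 : y ≤ 1 := by nlinarith
    have hκy : 0 ≤ 1 - κ * y := by nlinarith
    have hκy1 : 1 - κ * y ≤ 1 := sub_le_self 1 (by positivity)
    have hnext : δ (m + 1) ^ s ≤ y * (1 - κ * y) := by
      calc δ (m + 1) ^ s ≤ (δ m * (1 - κ * y)) ^ s :=
            Real.rpow_le_rpow (h0 _ le_rfl) (hrec m m.lt_succ_self) (by linarith)
        _ = y * (1 - κ * y) ^ s := Real.mul_rpow hδ hκy
        _ ≤ y * (1 - κ * y) := by
          gcongr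
          simpa using Real.rpow_le_rpow_of_exponent_ge' hκy hκy1 zero_le_one hs
    calc δ (m + 1) ^ s * (1 + κ * (m + 1 : ℕ))
        ≤ y * (1 - κ * y) * (1 + κ * (m + 1 : ℕ)) := by gcongr
      _ = y * (1 + κ * m) * (1 - κ * y) + κ * y * (1 - κ * y) := by push_cast; ring
      _ ≤ 1 * (1 - κ * y) + κ * y * 1 := by gcongr
      _ = 1 := by ring

theorem le_rpow_of_recursion {κ s : ℝ} (hκ : 0 < κ) (hκ1 : κ ≤ 1) (hs : 1 ≤ s) {δ : ℕ → ℝ}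
    {m : ℕ} (h0 : ∀ i ≤ m, 0 ≤ δ i) (h1 : δ 0 ≤ 1)
    (hrec : ∀ i < m, δ (i + 1) ≤ δ i * (1 - κ * δ i ^ s)) :
    δ m ≤ (κ * (1 + m)) ^ (-(1 / s)) := by
  have hδ := h0 m le_rfl
  have hpos : 0 < κ * (1 + m) := by positivity
  rw [Real.rpow_neg hpos.le, ← Real.inv_rpow hpos.le, one_div,
    Real.le_rpow_inv_iff_of_pos hδ (by positivity) (by linarith), ← one_div, le_div_iff₀ hpos]
  refine le_trans ?_ (rpow_mul_one_add_le_one_of_recursion hκ.le hκ1 hs h0 h1 hrec)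
  gcongr
  linarith

/-- The constant in the rate of convergence of the Weak Chebyshev Greedy Algorithm with weakness
parameter `t` in a space whose modulus of smoothness has power type `q` with constant `K`. -/
noncomputable def wcgaConst (K q t : ℝ) : ℝ :=
  (descentRate K q * t ^ (q / (q - 1))) ^ (-(1 - 1 / q))

theorem one_le_wcgaConst (hK : 1 ≤ K) (hq : 1 < q) (ht : 0 < t) (ht1 : t ≤ 1) :
    1 ≤ wcgaConst K q t := by
  have := descentRate_pos (K := K) (q := q) (by linarith)
  have : 0 < q - 1 := by linarith
  refine Real.one_le_rpow_of_pos_of_le_one_of_nonpos (by positivity)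
    (mul_le_one₀ (descentRate_le_one hK hq) (by positivity)
      (Real.rpow_le_one ht.le ht1 (by positivity))) ?_
  rw [Left.neg_nonpos_iff, sub_nonneg, div_le_one (by linarith)]
  exact hq.le

theorem HasPowerSmoothness.wcga_rate (hX : HasPowerSmoothness X K q) (hK : 1 ≤ K) (hq : 1 < q)
    (ht : 0 < t) (ht1 : t ≤ 1) (hED : E ⊆ D) (hψ : ∀ k ∈ D, ‖ψ k‖ ≤ 1)
    (hg : IsWCGAResult t ψ D (∑ k ∈ E, coef k • ψ k) m g) :
    ‖∑ k ∈ E, coef k • ψ k - g‖ ≤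
      wcgaConst K q t * (1 + m : ℝ) ^ (-(1 - 1 / q)) * ∑ k ∈ E, ‖coef k‖ := by
  obtain ⟨φ, G, hbest, hchoice, rfl⟩ := isWCGAResult_iff.1 hg
  have hle (i : ℕ) (hi : i ≤ m) : ‖∑ k ∈ E, coef k • ψ k - G i‖ ≤ ∑ k ∈ E, ‖coef k‖ :=
    (hbest i hi).norm_sub_le_norm.trans (norm_sum_smul_le fun k hk => hψ k (hED hk))
  have hrec (i : ℕ) (hi : i < m) := hX.norm_sub_le_of_isGreedyChoice (by linarith) hq ht.le hED
    hψ (greedySpan_mono ψ φ i.le_succ) (mem_greedySpan_succ ψ φ i) (hbest i hi.le)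
    (hbest (i + 1) hi) (hchoice i hi)
  have hB0 : 0 ≤ ∑ k ∈ E, ‖coef k‖ := Finset.sum_nonneg fun _ _ => norm_nonneg _
  set B := ∑ k ∈ E, ‖coef k‖
  rcases hB0.eq_or_lt with hB | hB
  · simpa [← hB] using hle m le_rfl
  have hκ := descentRate_pos (K := K) (q := q) (by linarith)
  have hq1 : 0 < q - 1 := by linarith
  have hs : 1 / (q / (q - 1)) = 1 - 1 / q := by field_simp
  rw [wcgaConst, ← Real.mul_rpow (by positivity) (by positivity), ← hs, ← div_le_iff₀ hB]
  refine le_rpow_of_recursion (δ := fun i => ‖∑ k ∈ E, coef k • ψ k - G i‖ / B) (by positivity)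
    (mul_le_one₀ (descentRate_le_one hK hq) (by positivity)
      (Real.rpow_le_one ht.le ht1 (by positivity)))
    (by rw [le_div_iff₀ hq1]; linarith) (fun i _ => by positivity)
    ((div_le_one hB).2 (hle 0 m.zero_le)) fun i hi => ?_
  rw [div_mul_eq_mul_div, mul_assoc (descentRate K q), ← Real.mul_rpow ht.le (by positivity)]
  gcongr
  exact hrec i hi

end WCGA

section TermApproximant

variable {X : Type*} [NormedAddCommGroup X] [NormedSpace ℂ X] {ι : Type*} {ψ : ι → X}

theorem IsTermApproximant.add {v₁ v₂ : ℕ} {Q : Finset ι} {g₁ g₂ : X}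
    (h₁ : IsTermApproximant v₁ ψ Q g₁) (h₂ : IsTermApproximant v₂ ψ Q g₂) :
    IsTermApproximant (v₁ + v₂) ψ Q (g₁ + g₂) := by
  classical
  obtain ⟨S₁, hS₁, hc₁, e₁, rfl⟩ := h₁
  obtain ⟨S₂, hS₂, hc₂, e₂, rfl⟩ := h₂
  refine ⟨S₁ ∪ S₂, Finset.union_subset hS₁ hS₂,
    (Finset.card_union_le _ _).trans (add_le_add hc₁ hc₂),
    fun k => (if k ∈ S₁ then e₁ k else 0) + if k ∈ S₂ then e₂ k else 0, ?_⟩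
  simp only [add_smul, Finset.sum_add_distrib, ite_smul, zero_smul, Finset.sum_ite_mem,
    Finset.union_inter_cancel_left, Finset.union_inter_cancel_right]

theorem IsTermApproximant.mono {v₁ v₂ : ℕ} {Q₁ Q₂ : Finset ι} {g : X}
    (h : IsTermApproximant v₁ ψ Q₁ g) (hv : v₁ ≤ v₂) (hQ : Q₁ ⊆ Q₂) :
    IsTermApproximant v₂ ψ Q₂ g := by
  obtain ⟨S, hS, hc, he⟩ := h
  exact ⟨S, hS.trans hQ, hc.trans hv, he⟩

theorem isTermApproximant_sum {κ : Type*} (s : Finset κ) {v : κ → ℕ} {Q : Finset ι} {g : κ → X}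
    (h : ∀ i ∈ s, IsTermApproximant (v i) ψ Q (g i)) :
    IsTermApproximant (∑ i ∈ s, v i) ψ Q (∑ i ∈ s, g i) := by
  classical
  induction s using Finset.induction_on with
  | empty => exact ⟨∅, Finset.empty_subset Q, le_rfl, 0, rfl⟩
  | insert i s hi ih =>
    rw [Finset.sum_insert hi, Finset.sum_insert hi]
    exact (h i (Finset.mem_insert_self i s)).add
      (ih fun j hj => h j (Finset.mem_insert_of_mem hj))

theorem IsWCGAResult.isTermApproximant {t : ℝ} {D : Finset ι} {r : X} {m : ℕ} {g : X}
    (h : IsWCGAResult t ψ D r m g) : IsTermApproximant m ψ D g := by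
  classical
  obtain ⟨φ, G, hbest, hchoice, rfl⟩ := isWCGAResult_iff.1 h
  have himage : (fun l => ψ (φ l)) '' Set.Iio m = ψ '' ((Finset.range m).image φ : Finset ι) := by
    rw [Finset.coe_image, Finset.coe_range, Set.image_image]
  have hmem := (hbest m le_rfl).1
  rw [greedySpan, himage] at hmem
  obtain ⟨e, he⟩ := (Submodule.mem_span_image_finset_iff_exists_fun' ℂ).1 hmem
  refine ⟨(Finset.range m).image φ, Finset.image_subset_iff.2 fun l hl => ?_,
    Finset.card_image_le.trans_eq (Finset.card_range m), e, he.symm⟩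
  exact (hchoice l (Finset.mem_range.1 hl)).1

theorem IsLargest.isTermApproximant {coef : ι → ℂ} {D I : Finset ι} {m : ℕ}
    (hI : IsLargest coef D m I) : IsTermApproximant m ψ D (∑ k ∈ I, coef k • ψ k) :=
  ⟨I, hI.1, hI.2.1.trans_le (min_le_left _ _), coef, rfl⟩

end TermApproximant

section Thresholding

variable {ι : Type*} {coef : ι → ℂ} {D E I : Finset ι} {β : ℝ} {m : ℕ}

theorem exists_isLargest (coef : ι → ℂ) (D : Finset ι) (m : ℕ) : ∃ I, IsLargest coef D m I := by
  classical
  induction m with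
  | zero => exact ⟨∅, by simp, by simp, by simp⟩
  | succ m ih =>
    obtain ⟨I, hI, hc, hmax⟩ := ih
    rcases le_or_gt D.card m with h | h
    · exact ⟨I, hI, by omega, hmax⟩
    have hne : (D \ I).Nonempty := by
      rw [← Finset.card_pos, Finset.card_sdiff_of_subset hI]; omega
    obtain ⟨k, hk, hkmax⟩ := (D \ I).exists_max_image (fun k => ‖coef k‖) hne
    rw [Finset.mem_sdiff] at hk
    refine ⟨insert k I, Finset.insert_subset hk.1 hI, ?_, ?_⟩
    · rw [Finset.card_insert_of_notMem hk.2]; omega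
    · intro x hx l hl hlI
      rw [Finset.mem_insert, not_or] at hlI
      rcases Finset.mem_insert.1 hx with rfl | hx
      · exact hkmax l (Finset.mem_sdiff.2 ⟨hl, hlI.2⟩)
      · exact hmax x hx l hl hlI.2

theorem isLargest_zero_empty (coef : ι → ℂ) (D : Finset ι) : IsLargest coef D 0 ∅ :=
  ⟨Finset.empty_subset D, by simp, by simp⟩

theorem IsLargest.eq_of_card_le (hI : IsLargest coef D m I) (hm : D.card ≤ m) : I = D :=
  Finset.eq_of_subset_of_card_le hI.1 (by rw [hI.2.1, min_eq_right hm])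

theorem IsLargest.mul_norm_rpow_le_sum (hI : IsLargest coef D m I) (hβ : 0 ≤ β) {l : ι}
    (hlD : l ∈ D) (hlI : l ∉ I) : (m + 1) * ‖coef l‖ ^ β ≤ ∑ k ∈ D, ‖coef k‖ ^ β := by
  classical
  have hcard : I.card = m := by
    rw [hI.2.1, min_eq_left_iff]
    by_contra! hm
    exact hlI (hI.eq_of_card_le hm.le ▸ hlD)
  calc (m + 1) * ‖coef l‖ ^ β = ∑ _k ∈ insert l I, ‖coef l‖ ^ β := by
        rw [Finset.sum_const, Finset.card_insert_of_notMem hlI, hcard, nsmul_eq_mul]; push_cast; rfl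
    _ ≤ ∑ k ∈ insert l I, ‖coef k‖ ^ β := by
        refine Finset.sum_le_sum fun k hk => Real.rpow_le_rpow (norm_nonneg _) ?_ hβ
        rcases Finset.mem_insert.1 hk with rfl | hk
        exacts [le_rfl, hI.2.2 k hk l hlD hlI]
    _ ≤ ∑ k ∈ D, ‖coef k‖ ^ β :=
        Finset.sum_le_sum_of_subset_of_nonneg (Finset.insert_subset hlD hI.1)
          fun _ _ _ => by positivity

theorem sum_norm_le_of_norm_rpow_le (hβ : 0 < β) (hβ' : β ≤ 1) {σ : ℝ}
    (hσ : ∀ k ∈ E, ‖coef k‖ ^ β ≤ σ) :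
    ∑ k ∈ E, ‖coef k‖ ≤ σ ^ (1 / β - 1) * ∑ k ∈ E, ‖coef k‖ ^ β := by
  have hexp : 0 ≤ 1 / β - 1 := sub_nonneg.2 ((one_le_div hβ).2 hβ')
  rw [Finset.mul_sum]
  refine Finset.sum_le_sum fun k hk => ?_
  calc ‖coef k‖ = (‖coef k‖ ^ β) ^ ((1 / β - 1) + 1) := by
        rw [sub_add_cancel, ← Real.rpow_mul (norm_nonneg _), mul_one_div_cancel hβ.ne',
          Real.rpow_one]
    _ = (‖coef k‖ ^ β) ^ (1 / β - 1) * ‖coef k‖ ^ β := by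
        rw [Real.rpow_add_of_nonneg (by positivity) hexp zero_le_one, Real.rpow_one]
    _ ≤ σ ^ (1 / β - 1) * ‖coef k‖ ^ β := by gcongr; exact hσ k hk

theorem IsLargest.sum_sdiff_norm_le [DecidableEq ι] (hI : IsLargest coef D m I) (hβ : 0 < β)
    (hβ' : β ≤ 1) : ∑ k ∈ D \ I, ‖coef k‖ ≤
      (1 + m : ℝ) ^ (1 - 1 / β) * (∑ k ∈ D, ‖coef k‖ ^ β) ^ (1 / β) := by
  have hm : (0 : ℝ) < 1 + m := by positivity
  have : 0 ≤ 1 / β - 1 := sub_nonneg.2 ((one_le_div hβ).2 hβ')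
  have hS : 0 ≤ ∑ k ∈ D, ‖coef k‖ ^ β := Finset.sum_nonneg fun _ _ => by positivity
  have hsub : ∑ k ∈ D \ I, ‖coef k‖ ^ β ≤ ∑ k ∈ D, ‖coef k‖ ^ β :=
    Finset.sum_le_sum_of_subset_of_nonneg Finset.sdiff_subset fun _ _ _ => by positivity
  have hσ (k) (hk : k ∈ D \ I) : ‖coef k‖ ^ β ≤ (∑ k ∈ D, ‖coef k‖ ^ β) / (1 + m) := by
    rw [le_div_iff₀ hm, mul_comm, add_comm]
    exact hI.mul_norm_rpow_le_sum hβ.le (Finset.mem_sdiff.1 hk).1 (Finset.mem_sdiff.1 hk).2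
  refine (sum_norm_le_of_norm_rpow_le hβ hβ' hσ).trans
    ((mul_le_mul_of_nonneg_left hsub (by positivity)).trans_eq ?_)
  set S := ∑ k ∈ D, ‖coef k‖ ^ β
  rw [Real.div_rpow hS hm.le, div_mul_eq_mul_div, div_eq_inv_mul, ← Real.rpow_neg hm.le, neg_sub]
  congr 1
  rw [← Real.rpow_add_one' hS (by simp [hβ.ne']), sub_add_cancel]

end Thresholding

section GreedyApproximation

variable {X : Type*} [NormedAddCommGroup X] [NormedSpace ℂ X] {K q t β : ℝ} {ι : Type*}
  {ψ : ι → X} {D I : Finset ι} {coef : ι → ℂ} {m : ℕ} {h : X}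

theorem norm_sum_smul_le_rpow_sum (hβ : 0 < β) (hβ' : β ≤ 1) (hψ : ∀ k ∈ D, ‖ψ k‖ ≤ 1) :
    ‖∑ k ∈ D, coef k • ψ k‖ ≤ (∑ k ∈ D, ‖coef k‖ ^ β) ^ (1 / β) := by
  classical
  refine (norm_sum_smul_le hψ).trans ?_
  simpa using (isLargest_zero_empty coef D).sum_sdiff_norm_le hβ hβ'

theorem HasPowerSmoothness.norm_sub_keep_add_wcga_le [DecidableEq ι]
    (hX : HasPowerSmoothness X K q) (hK : 1 ≤ K) (hq : 1 < q) (hβ : 0 < β) (hβ' : β ≤ 1)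
    (ht : 0 < t) (ht1 : t ≤ 1) (hψ : ∀ k ∈ D, ‖ψ k‖ ≤ 1) (hI : IsLargest coef D m I)
    (hh : IsWCGAResult t ψ D (∑ k ∈ D \ I, coef k • ψ k) m h) :
    ‖∑ k ∈ D, coef k • ψ k - (∑ k ∈ I, coef k • ψ k + h)‖ ≤
      wcgaConst K q t * (1 + m : ℝ) ^ (-(1 / β - 1 / q)) *
        (∑ k ∈ D, ‖coef k‖ ^ β) ^ (1 / β) := by
  have hC := one_le_wcgaConst hK hq ht ht1
  have hm : (0 : ℝ) < 1 + m := by positivity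
  rw [← Finset.sum_sdiff hI.1, add_comm, add_sub_add_left_eq_sub]
  calc ‖∑ k ∈ D \ I, coef k • ψ k - h‖
      ≤ wcgaConst K q t * (1 + m : ℝ) ^ (-(1 - 1 / q)) * ∑ k ∈ D \ I, ‖coef k‖ :=
        hX.wcga_rate hK hq ht ht1 Finset.sdiff_subset hψ hh
    _ ≤ wcgaConst K q t * (1 + m : ℝ) ^ (-(1 - 1 / q)) *
          ((1 + m : ℝ) ^ (1 - 1 / β) * (∑ k ∈ D, ‖coef k‖ ^ β) ^ (1 / β)) := by
        gcongr; exact hI.sum_sdiff_norm_le hβ hβ'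
    _ = wcgaConst K q t * ((1 + m : ℝ) ^ (-(1 - 1 / q)) * (1 + m : ℝ) ^ (1 - 1 / β)) *
          (∑ k ∈ D, ‖coef k‖ ^ β) ^ (1 / β) := by ring
    _ = _ := by rw [← Real.rpow_add hm]; congr 3; ring

theorem sub_keep_add_wcga_eq_zero [DecidableEq ι] (hm : D.card ≤ m) (hI : IsLargest coef D m I)
    (hh : IsWCGAResult t ψ D (∑ k ∈ D \ I, coef k • ψ k) 0 h) :
    ∑ k ∈ D, coef k • ψ k - (∑ k ∈ I, coef k • ψ k + h) = 0 := by
  obtain ⟨-, G, hG, -, rfl⟩ := hh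
  rw [hI.eq_of_card_le hm, hG, add_zero, sub_self]

end GreedyApproximation

section Layers

variable {d : ℕ}

/-- The index of the hyperbolic layer that contains `k`. -/
def layerIndex (k : Fin d → ℤ) : ℕ := ∑ i, Nat.size (k i).natAbs

theorem mem_block {s : Fin d → ℕ} {k : Fin d → ℤ} :
    k ∈ block s ↔ ∀ i, Nat.size (k i).natAbs = s i := by
  simp only [block, Fintype.mem_piFinset, Finset.mem_filter, Finset.mem_Ioo]
  refine forall_congr' fun i => ?_
  have hupper : (-(2 ^ s i : ℤ) < k i ∧ k i < 2 ^ s i) ↔ Nat.size (k i).natAbs ≤ s i := by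
    rw [Nat.size_le, ← abs_lt, Int.abs_eq_natAbs]
    exact_mod_cast Iff.rfl
  have hlower : 2 ^ s i / 2 ≤ (k i).natAbs ↔ s i ≤ Nat.size (k i).natAbs := by
    rcases s i with _ | m
    · simp
    · rw [pow_succ, Nat.mul_div_cancel _ two_pos, Nat.succ_le_iff, Nat.lt_size]
  rw [hupper, hlower, le_antisymm_iff]

theorem mem_layer {j : ℕ} {k : Fin d → ℤ} : k ∈ layer d j ↔ layerIndex k = j := by
  simp only [layer, Finset.mem_biUnion, Finset.mem_piAntidiag, mem_block]
  constructor
  · rintro ⟨s, ⟨hs, -⟩, hk⟩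
    simp only [layerIndex, hk, hs]
  · intro hk
    exact ⟨fun i => Nat.size (k i).natAbs, ⟨hk, by simp⟩, fun i => rfl⟩

theorem layer_nonempty (hd : 1 ≤ d) (j : ℕ) : (layer d j).Nonempty := by
  refine ⟨Pi.single ⟨0, hd⟩ ((2 ^ j / 2 : ℕ) : ℤ), mem_layer.2 ?_⟩
  rw [layerIndex, Finset.sum_eq_single ⟨0, hd⟩ (fun i _ hi => by simp [hi]) (by simp),
    Pi.single_eq_same, Int.natAbs_natCast]
  rcases j with _ | j
  · simp
  · rw [pow_succ, Nat.mul_div_cancel _ two_pos, Nat.size_pow]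

theorem card_block_le (s : Fin d → ℕ) : (block s).card ≤ 2 ^ d * 2 ^ ∑ i, s i := by
  rw [block, Fintype.card_piFinset]
  calc ∏ i, _ ≤ ∏ i, (2 * 2 ^ s i) := by
        refine Finset.prod_le_prod' fun i _ => (Finset.card_filter_le _ _).trans ?_
        rw [Int.card_Ioo, Int.toNat_le]
        push_cast
        linarith
    _ = _ := by
        rw [Finset.prod_mul_distrib, Finset.prod_const, Finset.prod_pow_eq_pow_sum,
          Finset.card_univ, Fintype.card_fin]

theorem card_piAntidiag_le (d j : ℕ) :
    (Finset.piAntidiag (Finset.univ : Finset (Fin d)) j).card ≤ (j + 1) ^ (d - 1) := by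
  rcases d with _ | d
  · exact (Finset.card_le_univ _).trans_eq (by simp)
  have hcard : (Fintype.piFinset fun _ : Fin d => Finset.range (j + 1)).card = (j + 1) ^ d := by
    simp
  rw [Nat.add_sub_cancel, ← hcard]
  -- The first coordinate of `s` is determined by `∑ i, s i = j` and the other ones.
  refine Finset.card_le_card_of_injOn (fun s i => s i.succ) (fun s hs => ?_) fun s hs t ht hst => ?_
  · refine Fintype.mem_piFinset.2 fun i => Finset.mem_range_succ_iff.2 ?_
    rw [← (Finset.mem_piAntidiag.1 hs).1]
    exact Finset.single_le_sum (fun _ _ => Nat.zero_le _) (Finset.mem_univ i.succ)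
  · have hsum : ∑ i, s i = ∑ i, t i :=
      (Finset.mem_piAntidiag.1 hs).1.trans (Finset.mem_piAntidiag.1 ht).1.symm
    have hsucc (i : Fin d) : s i.succ = t i.succ := congrFun hst i
    simp only [Fin.sum_univ_succ, hsucc, Nat.add_right_cancel_iff] at hsum
    exact funext (Fin.cases hsum hsucc)

theorem card_layer_le (d j : ℕ) : (layer d j).card ≤ 2 ^ d * (j + 1) ^ (d - 1) * 2 ^ j := by
  calc (layer d j).card
      ≤ (Finset.piAntidiag (Finset.univ : Finset (Fin d)) j).card * (2 ^ d * 2 ^ j) :=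
        Finset.card_biUnion_le_card_mul _ _ _ fun s hs => (card_block_le s).trans_eq (by
          rw [(Finset.mem_piAntidiag.1 hs).1])
    _ ≤ (j + 1) ^ (d - 1) * (2 ^ d * 2 ^ j) := by gcongr; exact card_piAntidiag_le d j
    _ = _ := by ring

theorem sum_card_layer_le (d n : ℕ) :
    ∑ j ∈ Finset.range n, (layer d j).card ≤ 2 ^ d * n ^ (d - 1) * (2 ^ n - 1) := by
  calc ∑ j ∈ Finset.range n, (layer d j).card
      ≤ ∑ j ∈ Finset.range n, 2 ^ d * n ^ (d - 1) * 2 ^ j := by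
        refine Finset.sum_le_sum fun j hj => (card_layer_le d j).trans ?_
        gcongr
        exact Finset.mem_range.1 hj
    _ = 2 ^ d * n ^ (d - 1) * (2 ^ n - 1) := by
        rw [← Finset.mul_sum, Nat.geomSum_eq le_rfl, Nat.div_one]

theorem hasSum_layer {X : Type*} [NormedAddCommGroup X] {x : (Fin d → ℤ) → X} {f : X}
    (h : HasSum x f) : HasSum (fun j => ∑ k ∈ layer d j, x k) f := by
  refine ((Equiv.sigmaFiberEquiv (layerIndex (d := d))).hasSum_iff.2 h).sigma fun j => ?_
  exact (Equiv.subtypeEquivRight fun k => mem_layer (j := j)).hasSum_iff.1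
    ((layer d j).hasSum x)

end Layers

section Run

variable {X : Type*} [NormedAddCommGroup X] [NormedSpace ℂ X] {d : ℕ} {M : GreedyMethod}
  {ψ : (Fin d → ℤ) → X} {f g : X} {coef : (Fin d → ℤ) → ℂ}

theorem GreedyMethod.exists_returns (hd : 1 ≤ d) (M : GreedyMethod) (ψ : (Fin d → ℤ) → X)
    (coef : (Fin d → ℤ) → ℂ) : ∃ g, M.Returns ψ coef g := by
  choose I hI using fun j => exists_isLargest coef (layer d j) (M.keep j)
  choose h hh using fun j => exists_isWCGAResult M.t_le_one ψ (layer_nonempty hd j)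
    (∑ k ∈ layer d j \ I j, coef k • ψ k) (M.steps j)
  exact ⟨_, I, h, fun j _ => ⟨hI j, hh j⟩, rfl⟩

theorem GreedyMethod.Returns.isTermApproximant (h : M.Returns ψ coef g) :
    IsTermApproximant (∑ j ∈ Finset.range M.J, (M.keep j + M.steps j)) ψ
      ((Finset.range M.J).biUnion (layer d)) g := by
  obtain ⟨I, h, hrun, rfl⟩ := h
  refine isTermApproximant_sum _ fun j hj => ?_
  obtain ⟨hI, hh⟩ := hrun j (Finset.mem_range.1 hj)
  exact (hI.isTermApproximant.add hh.isTermApproximant).mono le_rfl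
    (Finset.subset_biUnion_of_mem _ hj)

theorem GreedyMethod.Returns.norm_sub_le (hg : M.Returns ψ coef g)
    (hf : HasSum (fun k => coef k • ψ k) f) {e : ℕ → ℝ} {s : ℝ} (he : HasSum e s)
    (hlow : ∀ j < M.J, ∀ I h, IsLargest coef (layer d j) (M.keep j) I →
      IsWCGAResult M.t ψ (layer d j) (∑ k ∈ layer d j \ I, coef k • ψ k) (M.steps j) h →
      ‖∑ k ∈ layer d j, coef k • ψ k - (∑ k ∈ I, coef k • ψ k + h)‖ ≤ e j)
    (hhigh : ∀ j, M.J ≤ j → ‖∑ k ∈ layer d j, coef k • ψ k‖ ≤ e j) : ‖f - g‖ ≤ s := by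
  obtain ⟨I, h, hrun, rfl⟩ := hg
  have hsum : HasSum
      ((Finset.range M.J : Set ℕ).indicator fun j => ∑ k ∈ I j, coef k • ψ k + h j)
      (∑ j ∈ Finset.range M.J, (∑ k ∈ I j, coef k • ψ k + h j)) := by
    rw [← Finset.sum_indicator_subset _ subset_rfl]
    exact hasSum_sum_of_ne_finset_zero fun j hj => Set.indicator_of_notMem hj _
  refine ((hasSum_layer hf).sub hsum).norm_le_of_bounded he fun j => ?_
  rcases lt_or_ge j M.J with hj | hj
  · rw [Set.indicator_of_mem (by simpa using hj)]
    exact hlow j hj _ _ (hrun j hj).1 (hrun j hj).2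
  · rw [Set.indicator_of_notMem (by simpa using hj), sub_zero]
    exact hhigh j hj

end Run

section RealBounds

theorem rpow_le_rpow_abs_mul_rpow {x y M γ : ℝ} (hx : 0 < x) (hy : 0 < y) (hxy : x ≤ M * y)
    (hyx : y ≤ M * x) : x ^ γ ≤ M ^ |γ| * y ^ γ := by
  have hM : 0 < M := pos_of_mul_pos_left (hx.trans_le hxy) hy.le
  rcases le_total 0 γ with hγ | hγ
  · rw [abs_of_nonneg hγ, ← Real.mul_rpow hM.le hy.le]
    exact Real.rpow_le_rpow hx.le hxy hγ
  · rw [abs_of_nonpos hγ, Real.rpow_neg hM.le, ← Real.inv_rpow hM.le,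
      ← Real.mul_rpow (inv_nonneg.2 hM.le) hy.le]
    exact Real.rpow_le_rpow_of_nonpos (by positivity) ((inv_mul_le_iff₀ hM).2 hyx) hγ

theorem summable_two_mul_succ_rpow_mul_rpow_neg {a : ℝ} (ha : 0 < a) (γ : ℝ) :
    Summable fun i : ℕ => (2 * ((i : ℝ) + 1)) ^ γ * (2 : ℝ) ^ (-(a * i)) := by
  set ρ : ℝ := 2 ^ (-a) with hρ
  have hρ0 : 0 < ρ := Real.rpow_pos_of_pos two_pos _
  have hρ1 : ‖ρ‖ < 1 := by
    rw [Real.norm_of_nonneg hρ0.le]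
    exact Real.rpow_lt_one_of_one_lt_of_neg one_lt_two (neg_lt_zero.2 ha)
  have hsucc := (summable_nat_add_iff (f := fun i : ℕ => (i : ℝ) ^ ⌈γ⌉₊ * ρ ^ i) 1).2
    (summable_pow_mul_geometric_of_norm_lt_one ⌈γ⌉₊ hρ1)
  refine (hsucc.mul_left (2 ^ γ * ρ⁻¹)).of_nonneg_of_le (fun i => by positivity) fun i => ?_
  calc (2 * ((i : ℝ) + 1)) ^ γ * (2 : ℝ) ^ (-(a * i)) = 2 ^ γ * ((i : ℝ) + 1) ^ γ * ρ ^ i := by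
        rw [Real.mul_rpow two_pos.le (by positivity), hρ, ← Real.rpow_mul_natCast two_pos.le,
          neg_mul]
    _ ≤ 2 ^ γ * ((i : ℝ) + 1) ^ ⌈γ⌉₊ * ρ ^ i := by
        gcongr
        rw [← Real.rpow_natCast]
        exact Real.rpow_le_rpow_of_exponent_le (by linarith [i.cast_nonneg (α := ℝ)])
          (Nat.le_ceil γ)
    _ = 2 ^ γ * ρ⁻¹ * (((i + 1 : ℕ) : ℝ) ^ ⌈γ⌉₊ * ρ ^ (i + 1)) := by
        push_cast
        rw [pow_succ]
        field_simp

end RealBounds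

section Budget

variable {r : ℝ} {v : ℕ}

/-- The number of coefficients that are kept, and of greedy iterations that are made, in the
`i`-th of the layers that are not recovered exactly: it decays geometrically with ratio `r`,
normalised so that all these layers together account for at most `v / 2` terms. -/
noncomputable def budget (r : ℝ) (v i : ℕ) : ℕ := ⌊(1 - r) / 4 * (v * r ^ (i + 1))⌋₊

theorem four_mul_sum_budget_le (hr : 0 ≤ r) (hr1 : r ≤ 1) (v N : ℕ) :
    4 * ∑ i ∈ Finset.range N, budget r v i ≤ v := by
  have : 0 ≤ 1 - r := sub_nonneg.2 hr1
  have hgeom : (∑ i ∈ Finset.range N, r ^ i) * (1 - r) * r ≤ 1 := by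
    rw [geom_sum_mul_neg]
    exact mul_le_one₀ (sub_le_self _ (pow_nonneg hr N)) hr hr1
  have hreal : 4 * ∑ i ∈ Finset.range N, (budget r v i : ℝ) ≤ v := by
    calc 4 * ∑ i ∈ Finset.range N, (budget r v i : ℝ)
        ≤ 4 * ∑ i ∈ Finset.range N, (1 - r) / 4 * (v * r ^ (i + 1)) := by
          gcongr with i
          exact Nat.floor_le (by positivity)
      _ = v * ((∑ i ∈ Finset.range N, r ^ i) * (1 - r) * r) := by
          simp only [Finset.mul_sum, Finset.sum_mul]
          exact Finset.sum_congr rfl fun i _ => by ring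
      _ ≤ v := mul_le_of_le_one_right v.cast_nonneg hgeom
  exact_mod_cast hreal

theorem exists_budget_eq_zero (hr : 0 < r) (hr1 : r < 1) (hv : 1 ≤ v) :
    ∃ N, r⁻¹ ^ N ≤ v ∧ ∀ i, N ≤ i → budget r v i = 0 := by
  obtain ⟨N, hN, hvN⟩ := exists_nat_pow_near (x := (v : ℝ)) (by exact_mod_cast hv)
    ((one_lt_inv₀ hr).2 hr1)
  refine ⟨N, hN, fun i hi => Nat.floor_eq_zero.2 ?_⟩
  have hlt : v * r ^ (i + 1) < 1 := by
    rw [inv_pow, lt_inv_comm₀ (by exact_mod_cast hv) (by positivity), ← one_div,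
      lt_div_iff₀' (by exact_mod_cast hv)] at hvN
    refine lt_of_le_of_lt ?_ hvN
    gcongr _ * ?_
    exact pow_le_pow_of_le_one hr.le hr1.le (by omega)
  exact (mul_le_of_le_one_left (by positivity) (by linarith)).trans_lt hlt

/-- The bound `2^(-a j) max(j, 1)^γ` for the `A_β`-quasinorm of the `j`-th layer. -/
noncomputable def layerBound (a γ : ℝ) (j : ℕ) : ℝ := (2 : ℝ) ^ (-(a * j)) * max (j : ℝ) 1 ^ γ

theorem layerBound_nonneg (a γ : ℝ) (j : ℕ) : 0 ≤ layerBound a γ j := by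
  unfold layerBound
  positivity

theorem layerBound_add_le (a γ : ℝ) (n i : ℕ) :
    layerBound a γ (n + i) ≤
      2 ^ (-(a * n)) * ((n : ℝ) + 1) ^ γ * ((2 * ((i : ℝ) + 1)) ^ |γ| * (2 ^ (-(a * i)))) := by
  have hmax : 1 ≤ max ((n + i : ℕ) : ℝ) 1 := le_max_right _ _
  have hmax' : (n : ℝ) + i ≤ max ((n + i : ℕ) : ℝ) 1 := by push_cast; exact le_max_left _ _
  have hpoly : max ((n + i : ℕ) : ℝ) 1 ^ γ ≤ (2 * ((i : ℝ) + 1)) ^ |γ| * ((n : ℝ) + 1) ^ γ := by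
    refine rpow_le_rpow_abs_mul_rpow (by positivity) (by positivity) (max_le ?_ ?_) ?_
    · push_cast; nlinarith [mul_nonneg n.cast_nonneg (i.cast_nonneg (α := ℝ))]
    · nlinarith [mul_nonneg n.cast_nonneg (i.cast_nonneg (α := ℝ))]
    · nlinarith [i.cast_nonneg (α := ℝ)]
  calc layerBound a γ (n + i) = 2 ^ (-(a * n)) * 2 ^ (-(a * i)) * max ((n + i : ℕ) : ℝ) 1 ^ γ := by
        rw [layerBound, ← Real.rpow_add two_pos]; push_cast; ring_nf
    _ ≤ 2 ^ (-(a * n)) * 2 ^ (-(a * i)) * ((2 * ((i : ℝ) + 1)) ^ |γ| * ((n : ℝ) + 1) ^ γ) := by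
        gcongr
    _ = _ := by ring

/-- The ratio of the budgets of consecutive layers. Its `α`-th power is the square root of the
ratio `2^(-a)` of the layer bounds, so that the errors of the layers still decay geometrically. -/
noncomputable def budgetRatio (a α : ℝ) : ℝ := 2 ^ (-(a / (2 * α)))

variable {a α : ℝ}

theorem budgetRatio_pos (a α : ℝ) : 0 < budgetRatio a α := Real.rpow_pos_of_pos two_pos _

theorem budgetRatio_lt_one (ha : 0 < a) (hα : 0 < α) : budgetRatio a α < 1 :=
  Real.rpow_lt_one_of_one_lt_of_neg one_lt_two (neg_lt_zero.2 (by positivity))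

/-- The factor by which the total error exceeds `v^(-α)` times the bound of the first layer that
is not recovered exactly. -/
noncomputable def tailConst (a α γ : ℝ) : ℝ :=
  ((1 - budgetRatio a α) / 4) ^ (-α) * 2 ^ (a / 2) *
    ∑' i : ℕ, (2 * ((i : ℝ) + 1)) ^ |γ| * (2 : ℝ) ^ (-(a / 2 * i))

theorem tailConst_pos (ha : 0 < a) (hα : 0 < α) (γ : ℝ) : 0 < tailConst a α γ := by
  have hr := sub_pos.2 (budgetRatio_lt_one ha hα)
  have hsum := (summable_two_mul_succ_rpow_mul_rpow_neg (half_pos ha) |γ|).tsum_pos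
    (fun i => by positivity) 0 (by positivity)
  unfold tailConst
  positivity

theorem one_add_budget_rpow_le (ha : 0 < a) (hα : 0 < α) (hv : 1 ≤ v) (i : ℕ) :
    (1 + budget (budgetRatio a α) v i : ℝ) ^ (-α) ≤
      ((1 - budgetRatio a α) / 4) ^ (-α) * 2 ^ (a / 2) * (v : ℝ) ^ (-α) * 2 ^ (a / 2 * i) := by
  have hr := budgetRatio_pos a α
  have hr1 := sub_pos.2 (budgetRatio_lt_one ha hα)
  have hv' : (0 : ℝ) < v := by exact_mod_cast hv
  have hpow : (budgetRatio a α ^ (i + 1)) ^ (-α) = 2 ^ (a / 2) * 2 ^ (a / 2 * i) := by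
    rw [← Real.rpow_natCast, ← Real.rpow_mul hr.le, budgetRatio, ← Real.rpow_mul two_pos.le,
      ← Real.rpow_add two_pos]
    congr 1
    push_cast
    field_simp
    ring
  calc (1 + budget (budgetRatio a α) v i : ℝ) ^ (-α)
      ≤ ((1 - budgetRatio a α) / 4 * (v * budgetRatio a α ^ (i + 1))) ^ (-α) := by
        refine Real.rpow_le_rpow_of_nonpos (by positivity) ?_ (neg_nonpos.2 hα.le)
        rw [add_comm (1 : ℝ)]
        exact (Nat.lt_floor_add_one _).le
    _ = _ := by
        rw [Real.mul_rpow (by positivity) (by positivity),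
          Real.mul_rpow hv'.le (by positivity), hpow]
        ring

theorem one_add_budget_rpow_mul_layerBound_le (ha : 0 < a) (hα : 0 < α) (γ : ℝ) (n : ℕ)
    (hv : 1 ≤ v) (i : ℕ) :
    (1 + budget (budgetRatio a α) v i : ℝ) ^ (-α) * layerBound a γ (n + i) ≤
      ((1 - budgetRatio a α) / 4) ^ (-α) * 2 ^ (a / 2) *
        ((v : ℝ) ^ (-α) * (2 ^ (-(a * n)) * ((n : ℝ) + 1) ^ γ)) *
        ((2 * ((i : ℝ) + 1)) ^ |γ| * 2 ^ (-(a / 2 * i))) := by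
  have hr := sub_pos.2 (budgetRatio_lt_one ha hα)
  set A := ((1 - budgetRatio a α) / 4) ^ (-α) * 2 ^ (a / 2)
  set B := (2 : ℝ) ^ (-(a * n)) * ((n : ℝ) + 1) ^ γ
  calc (1 + budget (budgetRatio a α) v i : ℝ) ^ (-α) * layerBound a γ (n + i)
      ≤ A * (v : ℝ) ^ (-α) * 2 ^ (a / 2 * i) *
          (B * ((2 * ((i : ℝ) + 1)) ^ |γ| * 2 ^ (-(a * i)))) := by
        gcongr
        exacts [layerBound_nonneg a γ _, one_add_budget_rpow_le ha hα hv i,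
          layerBound_add_le a γ n i]
    _ = A * ((v : ℝ) ^ (-α) * B) *
          ((2 * ((i : ℝ) + 1)) ^ |γ| * (2 ^ (a / 2 * i) * 2 ^ (-(a * i)))) := by ring
    _ = _ := by
        rw [← Real.rpow_add two_pos]
        ring_nf

theorem exists_hasSum_budget_layerBound_le (ha : 0 < a) (hα : 0 < α) (γ : ℝ) (n : ℕ)
    (hv : 1 ≤ v) : ∃ e : ℕ → ℝ,
    (∀ i, (1 + budget (budgetRatio a α) v i : ℝ) ^ (-α) * layerBound a γ (n + i) ≤ e i) ∧
      HasSum e (tailConst a α γ * ((v : ℝ) ^ (-α) * (2 ^ (-(a * n)) * ((n : ℝ) + 1) ^ γ))) := by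
  refine ⟨_, one_add_budget_rpow_mul_layerBound_le ha hα γ n hv, ?_⟩
  rw [tailConst, mul_right_comm (_ * _)]
  exact (summable_two_mul_succ_rpow_mul_rpow_neg (half_pos ha) |γ|).hasSum.mul_left _

end Budget

section Level

variable {d n v : ℕ}

theorem exists_level (hd : 1 ≤ d) (hv : 1 ≤ v) :
    ∃ n, 2 * ∑ j ∈ Finset.range n, (layer d j).card ≤ v ∧ 2 ^ n ≤ v ∧
      v ≤ 2 ^ (d + 2) * ((n + 1) ^ (d - 1) * 2 ^ n) := by
  have hlarge : ∃ n, v < 2 ^ (d + 1) * (n ^ (d - 1) * (2 ^ n - 1)) := by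
    refine ⟨v + 1, lt_of_lt_of_le ?_ (Nat.le_mul_of_pos_left _ (by positivity))⟩
    have hpow := (v + 1).lt_two_pow_self
    exact lt_of_lt_of_le (by omega) (Nat.le_mul_of_pos_left _ (by positivity))
  obtain ⟨n, hn, hn'⟩ := Nat.exists_not_and_succ_of_not_zero_of_exists (by simp) hlarge
  rw [not_lt] at hn
  refine ⟨n, ?_, ?_, hn'.le.trans ?_⟩
  · calc 2 * ∑ j ∈ Finset.range n, (layer d j).card
        ≤ 2 * (2 ^ d * n ^ (d - 1) * (2 ^ n - 1)) := by gcongr; exact sum_card_layer_le d n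
      _ = 2 ^ (d + 1) * (n ^ (d - 1) * (2 ^ n - 1)) := by ring
      _ ≤ v := hn
  · rcases n.eq_zero_or_pos with rfl | hn0
    · exact hv
    have htwo : 2 ≤ 2 ^ n := Nat.le_self_pow hn0.ne' 2
    calc 2 ^ n ≤ 2 ^ 1 * (1 * (2 ^ n - 1)) := by omega
      _ ≤ 2 ^ (d + 1) * (n ^ (d - 1) * (2 ^ n - 1)) := by
        gcongr
        exacts [one_le_two, by omega, Nat.one_le_pow _ _ hn0]
      _ ≤ v := hn
  · calc 2 ^ (d + 1) * ((n + 1) ^ (d - 1) * (2 ^ (n + 1) - 1))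
        ≤ 2 ^ (d + 1) * ((n + 1) ^ (d - 1) * 2 ^ (n + 1)) := by gcongr; exact Nat.sub_le _ _
      _ = 2 ^ (d + 2) * ((n + 1) ^ (d - 1) * 2 ^ n) := by ring

theorem succ_level_le_log (hn : 2 ^ n ≤ v) : (n : ℝ) + 1 ≤ 2 * Real.log (2 * v) := by
  have hlog : ((n : ℝ) + 1) * Real.log 2 ≤ Real.log (2 * v) := by
    have hle : (2 : ℝ) ^ (n + 1) ≤ 2 * v := by
      rw [pow_succ']
      exact_mod_cast Nat.mul_le_mul_left 2 hn
    simpa using Real.log_le_log (by positivity) hle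
  nlinarith [Real.log_two_gt_d9]

theorem log_le_succ_level (hv : 1 ≤ v) (hn : v ≤ 2 ^ (d + 2) * ((n + 1) ^ (d - 1) * 2 ^ n)) :
    Real.log (2 * v) ≤ (d + 3) * ((n : ℝ) + 1) := by
  have hpow : n + 1 ≤ 2 ^ n := n.lt_two_pow_self
  have hle : 2 * v ≤ 2 ^ ((d + 3) * (n + 1)) := by
    calc 2 * v ≤ 2 * (2 ^ (d + 2) * ((2 ^ n) ^ (d - 1) * 2 ^ n)) := by
          gcongr; exact hn.trans (by gcongr)
      _ = 2 ^ (1 + (d + 2) + n * (d - 1) + n) := by ring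
      _ ≤ 2 ^ ((d + 3) * (n + 1)) := by
          gcongr
          · exact one_le_two
          · have := Nat.mul_le_mul_left n (d.sub_le 1)
            linarith
  have hle' : (2 : ℝ) * v ≤ 2 ^ ((d + 3) * (n + 1)) := by exact_mod_cast hle
  calc Real.log (2 * v) ≤ ((d + 3) * (n + 1) : ℕ) * Real.log 2 := by
        rw [← Real.log_pow]
        exact Real.log_le_log (by positivity) hle'
    _ ≤ ((d + 3) * (n + 1) : ℕ) * 1 := by
        gcongr
        linarith [Real.log_two_lt_d9]
    _ = _ := by push_cast; ring

theorem rpow_neg_level_le {a : ℝ} (hd : 1 ≤ d) (ha : 0 ≤ a) (hv : 1 ≤ v)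
    (hn : v ≤ 2 ^ (d + 2) * ((n + 1) ^ (d - 1) * 2 ^ n)) :
    (2 : ℝ) ^ (-(a * n)) ≤
      (2 ^ (d + 2)) ^ a * ((n : ℝ) + 1) ^ (((d : ℝ) - 1) * a) * (v : ℝ) ^ (-a) := by
  have hv' : (0 : ℝ) < v := by exact_mod_cast hv
  have hn' : (v : ℝ) ≤ 2 ^ (d + 2) * (((n : ℝ) + 1) ^ ((d : ℝ) - 1) * 2 ^ (n : ℝ)) := by
    rw [← Nat.cast_pred hd, Real.rpow_natCast, Real.rpow_natCast]
    exact_mod_cast hn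
  have hva : (v : ℝ) ^ a ≤
      (2 ^ (d + 2)) ^ a * (((n : ℝ) + 1) ^ (((d : ℝ) - 1) * a) * 2 ^ (a * n)) := by
    refine (Real.rpow_le_rpow hv'.le hn' ha).trans_eq ?_
    rw [Real.mul_rpow (by positivity) (by positivity),
      Real.mul_rpow (by positivity) (by positivity), ← Real.rpow_mul (by positivity),
      ← Real.rpow_mul two_pos.le, mul_comm (n : ℝ)]
  rw [Real.rpow_neg two_pos.le, Real.rpow_neg hv'.le, ← div_eq_mul_inv,
    le_div_iff₀ (by positivity), inv_mul_le_iff₀ (by positivity)]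
  linarith

/-- The constant in the passage from `n` to `v`, for a level `n` with `2 ^ n * n ^ (d - 1) ≍ v`. -/
noncomputable def levelConst (d : ℕ) (a b : ℝ) : ℝ :=
  (2 ^ (d + 2)) ^ a * (d + 3) ^ |((d : ℝ) - 1) * (a + b)|

theorem levelConst_pos (d : ℕ) (a b : ℝ) : 0 < levelConst d a b := by
  unfold levelConst
  positivity

theorem rpow_neg_level_mul_le {a : ℝ} (hd : 1 ≤ d) (ha : 0 ≤ a) (b : ℝ) (hv : 1 ≤ v)
    (hvn : 2 ^ n ≤ v) (hn : v ≤ 2 ^ (d + 2) * ((n + 1) ^ (d - 1) * 2 ^ n)) :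
    (2 : ℝ) ^ (-(a * n)) * ((n : ℝ) + 1) ^ (((d : ℝ) - 1) * b) ≤
      levelConst d a b * ((v : ℝ) ^ (-a) * Real.log (2 * v) ^ (((d : ℝ) - 1) * (a + b))) := by
  have hy : (0 : ℝ) < (n : ℝ) + 1 := by positivity
  have hlog : 0 < Real.log (2 * v) := by linarith [succ_level_le_log hvn]
  have hpoly : ((n : ℝ) + 1) ^ (((d : ℝ) - 1) * (a + b)) ≤
      (d + 3) ^ |((d : ℝ) - 1) * (a + b)| * Real.log (2 * v) ^ (((d : ℝ) - 1) * (a + b)) :=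
    rpow_le_rpow_abs_mul_rpow hy hlog
      ((succ_level_le_log hvn).trans (by gcongr; linarith [d.cast_nonneg (α := ℝ)]))
      (log_le_succ_level hv hn)
  calc (2 : ℝ) ^ (-(a * n)) * ((n : ℝ) + 1) ^ (((d : ℝ) - 1) * b)
      ≤ (2 ^ (d + 2)) ^ a * ((n : ℝ) + 1) ^ (((d : ℝ) - 1) * a) * (v : ℝ) ^ (-a) *
          ((n : ℝ) + 1) ^ (((d : ℝ) - 1) * b) := by
        gcongr; exact rpow_neg_level_le hd ha hv hn
    _ = (2 ^ (d + 2)) ^ a * (v : ℝ) ^ (-a) * ((n : ℝ) + 1) ^ (((d : ℝ) - 1) * (a + b)) := by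
        rw [mul_add, Real.rpow_add hy]; ring
    _ ≤ (2 ^ (d + 2)) ^ a * (v : ℝ) ^ (-a) * ((d + 3) ^ |((d : ℝ) - 1) * (a + b)| *
          Real.log (2 * v) ^ (((d : ℝ) - 1) * (a + b))) := by gcongr
    _ = _ := by rw [levelConst]; ring

theorem card_biUnion_layer_le (hd : 1 ≤ d) (J : ℕ) :
    ((Finset.range J).biUnion (layer d)).card ≤ (2 ^ J) ^ (2 * d) := by
  rcases J.eq_zero_or_pos with rfl | hJ
  · simp
  calc ((Finset.range J).biUnion (layer d)).card
      ≤ ∑ j ∈ Finset.range J, (layer d j).card := Finset.card_biUnion_le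
    _ ≤ 2 ^ d * J ^ (d - 1) * (2 ^ J - 1) := sum_card_layer_le d J
    _ ≤ (2 ^ J) ^ d * (2 ^ J) ^ (d - 1) * 2 ^ J := by
        gcongr
        exacts [Nat.le_self_pow hJ.ne' 2, J.lt_two_pow_self.le, Nat.sub_le _ _]
    _ = (2 ^ J) ^ (2 * d) := by
        rw [mul_assoc, ← pow_succ, Nat.sub_add_cancel hd, ← pow_add, two_mul]

end Level

section BudgetMethod

/-- The layerwise greedy method that recovers the first `n` layers exactly, and distributes the
remaining budget over the next `N` layers. -/
noncomputable def budgetMethod (d n N v : ℕ) (r t : ℝ) (ht : 0 < t) (ht1 : t ≤ 1) :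
    GreedyMethod where
  t := t
  t_pos := ht
  t_le_one := ht1
  J := n + N
  keep j := if j < n then (layer d j).card else budget r v (j - n)
  steps j := if j < n then 0 else budget r v (j - n)

variable {d n N v : ℕ} {a r t : ℝ} {ht : 0 < t} {ht1 : t ≤ 1}

theorem sum_keep_add_steps_budgetMethod_le (hr : 0 ≤ r) (hr1 : r ≤ 1)
    (hn : 2 * ∑ j ∈ Finset.range n, (layer d j).card ≤ v) :
    ∑ j ∈ Finset.range (n + N), ((budgetMethod d n N v r t ht ht1).keep j +
      (budgetMethod d n N v r t ht ht1).steps j) ≤ v := by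
  have hbudget := four_mul_sum_budget_le hr hr1 v N
  have hexact : ∑ j ∈ Finset.range n, ((budgetMethod d n N v r t ht ht1).keep j +
      (budgetMethod d n N v r t ht ht1).steps j) = ∑ j ∈ Finset.range n, (layer d j).card :=
    Finset.sum_congr rfl fun j hj => by simp [budgetMethod, Finset.mem_range.1 hj]
  rw [Finset.sum_range_add, hexact]
  simp only [budgetMethod, Nat.not_lt.2 (Nat.le_add_right n _), if_false, Nat.add_sub_cancel_left,
    Finset.sum_add_distrib]
  omega

theorem norm_sub_le_of_returns_budgetMethod {X : Type*} [NormedAddCommGroup X] [NormedSpace ℂ X]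
    {K q b β : ℝ} {ψ : (Fin d → ℤ) → X} {f g : X} {coef : (Fin d → ℤ) → ℂ}
    (hX : HasPowerSmoothness X K q) (hK : 1 ≤ K) (hq : 1 < q) (hβ : 0 < β) (hβ' : β ≤ 1)
    (hψ : ∀ k, ‖ψ k‖ ≤ 1) (hf : IsAdmissibleRep a b β ψ f coef)
    (hN : ∀ i, N ≤ i → budget r v i = 0) {e : ℕ → ℝ} {s : ℝ} (hs : HasSum e s)
    (he : ∀ i, (1 + budget r v i : ℝ) ^ (-(1 / β - 1 / q)) *
      layerBound a (((d : ℝ) - 1) * b) (n + i) ≤ e i)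
    (hg : (budgetMethod d n N v r t ht ht1).Returns ψ coef g) :
    ‖f - g‖ ≤ wcgaConst K q t * s := by
  have hC := one_le_wcgaConst hK hq ht ht1
  set E : ℕ → ℝ := fun j => if j < n then 0 else wcgaConst K q t * e (j - n)
  have hE : HasSum E (wcgaConst K q t * s) := by
    rw [← hasSum_nat_add_iff' n, Finset.sum_eq_zero fun j hj => if_pos (Finset.mem_range.1 hj),
      sub_zero]
    simpa [E] using hs.mul_left (wcgaConst K q t)
  refine hg.norm_sub_le hf.2.1 hE (fun j _ I h hI hh => ?_) fun j hj => ?_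
  · by_cases hjn : j < n
    · simp only [budgetMethod, if_pos hjn] at hI hh
      simp only [E, if_pos hjn, sub_keep_add_wcga_eq_zero le_rfl hI hh, norm_zero, le_rfl]
    · simp only [budgetMethod, if_neg hjn] at hI hh
      have hej := he (j - n)
      rw [Nat.add_sub_of_le (not_lt.1 hjn)] at hej
      simp only [E, if_neg hjn]
      refine (hX.norm_sub_keep_add_wcga_le hK hq hβ hβ' ht ht1 (fun k _ => hψ k) hI hh).trans ?_
      rw [mul_assoc]
      gcongr
      exact (mul_le_mul_of_nonneg_left (hf.2.2 j) (by positivity)).trans hej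
  · have hnj : n ≤ j := (Nat.le_add_right n N).trans hj
    have hej := he (j - n)
    rw [hN (j - n) (Nat.le_sub_of_add_le' hj), Nat.add_sub_of_le hnj, Nat.cast_zero, add_zero,
      Real.one_rpow, one_mul] at hej
    simp only [E, if_neg (not_lt.2 hnj)]
    have hej' := (norm_sum_smul_le_rpow_sum hβ hβ' fun k _ => hψ k).trans ((hf.2.2 j).trans hej)
    exact hej'.trans (le_mul_of_one_le_left ((norm_nonneg _).trans hej') hC)

theorem inv_budgetRatio_rpow (ha : 0 < a) {α : ℝ} (hα : 0 < α) (N : ℕ) :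
    ((budgetRatio a α)⁻¹ ^ N) ^ (2 * α / a) = 2 ^ N := by
  rw [budgetRatio, ← Real.rpow_neg two_pos.le, neg_neg, ← Real.rpow_mul_natCast two_pos.le,
    ← Real.rpow_mul two_pos.le, ← Real.rpow_natCast 2 N]
  congr 1
  field_simp

theorem card_biUnion_layer_le_rpow {α : ℝ} (hd : 1 ≤ d) (ha : 0 < a) (hα : 0 < α) (hv : 1 ≤ v)
    (hn : 2 ^ n ≤ v) (hN : (budgetRatio a α)⁻¹ ^ N ≤ v) :
    (((Finset.range (n + N)).biUnion (layer d)).card : ℝ) ≤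
      (v : ℝ) ^ ((1 + 2 * α / a) * (2 * d)) := by
  have hv' : (0 : ℝ) < v := by exact_mod_cast hv
  have hr := budgetRatio_pos a α
  have hJ : (2 : ℝ) ^ (n + N) ≤ (v : ℝ) ^ (1 + 2 * α / a) := by
    rw [pow_add, Real.rpow_add hv', Real.rpow_one, ← inv_budgetRatio_rpow ha hα N]
    gcongr
    exact_mod_cast hn
  calc (((Finset.range (n + N)).biUnion (layer d)).card : ℝ) ≤ (2 ^ (n + N)) ^ (2 * d) := by
        exact_mod_cast card_biUnion_layer_le hd (n + N)
    _ ≤ ((v : ℝ) ^ (1 + 2 * α / a)) ^ (2 * d) := by gcongr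
    _ = _ := by
        rw [← Real.rpow_mul_natCast hv'.le]
        push_cast
        rfl

end BudgetMethod

end MixedGreedy

open MixedGreedy in
theorem theorem5p1_general (d : ℕ) (hd : 1 ≤ d) (q : ℝ) (hq : 1 < q) (a : ℝ) (ha : 0 < a) (β : ℝ)
    (hβ : 0 < β) (hβ' : β ≤ 1) :
    ∃ c : ℝ, 0 < c ∧ ∀ K b t : ℝ, 0 < t → t ≤ 1 → ∃ C : ℝ, 0 < C ∧
      ∀ v : ℕ, 1 ≤ v →
        ∃ (Q : Finset (Fin d → ℤ)) (M : GreedyMethod), M.t = t ∧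
          (Q.card : ℝ) ≤ (v : ℝ) ^ c ∧
          ∀ (X : Type*) [NormedAddCommGroup X] [NormedSpace ℂ X], HasPowerSmoothness X K q →
            ∀ ψ : (Fin d → ℤ) → X, (∀ k, ‖ψ k‖ ≤ 1) →
            ∀ f coef, IsAdmissibleRep a b β ψ f coef →
              (∃ g, M.Returns ψ coef g) ∧
              ∀ g, M.Returns ψ coef g → IsTermApproximant v ψ Q g ∧
                ‖f - g‖ ≤ C * (v : ℝ) ^ (-a + 1 / q - 1 / β) *
                  Real.log (2 * v) ^ (((d : ℝ) - 1) * (a + b)) := by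
  set α : ℝ := 1 / β - 1 / q with hα_def
  have hα : 0 < α := sub_pos.2 (one_div_lt_one_div_of_lt hβ (hβ'.trans_lt hq))
  have : (0 : ℝ) < d := by exact_mod_cast hd
  refine ⟨(1 + 2 * α / a) * (2 * d), by positivity, fun K b t ht ht1 => ?_⟩
  have hr := budgetRatio_pos a α
  have hr1 := budgetRatio_lt_one ha hα
  set γ : ℝ := ((d : ℝ) - 1) * b
  have hC := one_le_wcgaConst (le_max_right K 1) hq ht ht1
  have hT := tailConst_pos ha hα γ
  have hL := levelConst_pos d a b
  refine ⟨wcgaConst (max K 1) q t * (tailConst a α γ * levelConst d a b), by positivity,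
    fun v hv => ?_⟩
  obtain ⟨n, hcard, hvn, hn⟩ := exists_level hd hv
  obtain ⟨N, hNv, hN⟩ := exists_budget_eq_zero hr hr1 hv
  refine ⟨_, budgetMethod d n N v (budgetRatio a α) t ht ht1, rfl,
    card_biUnion_layer_le_rpow hd ha hα hv hvn hNv, fun X _ _ hX ψ hψ f coef hf =>
    ⟨GreedyMethod.exists_returns hd _ ψ coef, fun g hg => ⟨hg.isTermApproximant.mono
      (sum_keep_add_steps_budgetMethod_le hr.le hr1.le hcard) subset_rfl, ?_⟩⟩⟩
  obtain ⟨e, he, hs⟩ := exists_hasSum_budget_layerBound_le ha hα γ n hv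
  refine (norm_sub_le_of_returns_budgetMethod (hX.mono (le_max_left K 1)) (le_max_right K 1)
    hq hβ hβ' hψ hf hN hs he hg).trans ?_
  have hv' : (0 : ℝ) < v := by exact_mod_cast hv
  calc wcgaConst (max K 1) q t * (tailConst a α γ *
        ((v : ℝ) ^ (-α) * (2 ^ (-(a * n)) * ((n : ℝ) + 1) ^ γ)))
      ≤ wcgaConst (max K 1) q t * (tailConst a α γ * ((v : ℝ) ^ (-α) * (levelConst d a b *
          ((v : ℝ) ^ (-a) * Real.log (2 * v) ^ (((d : ℝ) - 1) * (a + b)))))) := by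
        gcongr _ * (_ * (_ * ?_))
        exact rpow_neg_level_mul_le hd ha.le b hv hvn hn
    _ = _ := by
        rw [show -a + 1 / q - 1 / β = -α + -a by rw [hα_def]; ring, Real.rpow_add hv']
        ring

theorem theorem5p1 (d : ℕ) (hd : 1 ≤ d) (p : ℝ≥0∞) [Fact (1 ≤ p)] (hp : 1 < p) (hp' : p ≠ ∞)
    (a : ℝ) (ha : 0 < a) (β : ℝ) (hβ : 0 < β) (hβ' : β ≤ 1) :
    ∃ c : ℝ, 0 < c ∧ ∀ b : ℝ, ∃ C : ℝ, 0 < C ∧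
      ∀ v : ℕ, 1 ≤ v →
        ∃ (Q : Finset (Fin d → ℤ)) (M : MixedGreedy.GreedyMethod),
          (Q.card : ℝ) ≤ (v : ℝ) ^ c ∧
          ∀ (Ω : Type*) [MeasurableSpace Ω] (μ : Measure Ω) [IsProbabilityMeasure μ]
            (ψ : (Fin d → ℤ) → Lp ℂ p μ), (∀ k, ‖ψ k‖ ≤ 1) →
            ∀ f ∈ MixedGreedy.mixedClass a b β ψ,
              ∀ coef, MixedGreedy.IsAdmissibleRep a b β ψ f coef →
                (∃ g, M.Returns ψ coef g) ∧
                ∀ g, M.Returns ψ coef g →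
                  MixedGreedy.IsTermApproximant v ψ Q g ∧
                  ‖f - g‖ ≤ C * (v : ℝ) ^ (-a + 1 / min p.toReal 2 - 1 / β) *
                    (Real.log (2 * v)) ^ (((d : ℝ) - 1) * (a + b)) := by
  have hq : 1 < min p.toReal 2 := lt_min
    (ENNReal.toReal_one ▸ (ENNReal.toReal_lt_toReal ENNReal.one_ne_top hp').2 hp) one_lt_two
  obtain ⟨K, hK⟩ := MixedGreedy.exists_hasPowerSmoothness_Lp ℂ p hp'
  obtain ⟨c, hc, h⟩ := theorem5p1_general d hd _ hq a ha β hβ hβ'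
  refine ⟨c, hc, fun b => (h K b 1 one_pos le_rfl).imp fun C hC => ⟨hC.1, fun v hv => ?_⟩⟩
  obtain ⟨Q, M, -, hQ, hM⟩ := hC.2 v hv
  exact ⟨Q, M, hQ, fun Ω _ μ _ ψ hψ f _ => hM (Lp ℂ p μ) (hK Ω μ) ψ hψ f⟩
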